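/- **Problem and assumptions.** Let $\lambda>0$, $f:\mathbb R^n\to\mathbb R$, $\varphi(x)=f(x)+\lambda\|x\|_1$, $x^0\in\mathbb R^n$, and $\mathcal L=\{x:\varphi(x)\le\varphi(x^0)\}$. Assume that $\mathcal L$ is bounded, that $f$ is continuous and is twice continuously differentiable with Lipschitz continuous Hessian on an open neighbourhood of $\mathcal L$, and that $\varphi$ attains its minimum $\varphi_{\rm low}$. Then there are constants $L_g,L_H>0$ such that for all $x,y\in\mathcal L$ $$f(y)\le f(x)+\nabla f(x)^\top(y-x)+\tfrac L2\|y-x\|^2\ \ (L\ge L_g),\qquad \|\nabla^2f(x)(y-x)-(\nabla f(y)-\nabla f(x))\|\le\tfrac{L_H}2\|y-x\|^2,$$ $$f(y)\le f(x)+\nabla f(x)^\top(y-x)+\tfrac12(y-x)^\top\nabla^2f(x)(y-x)+\tfrac{L_H}6\|y-x\|^3,\qquad \|\nabla^2 f(x)\|\le L_g ,$$ and the result below holds for every such pair $L_g,L_H$. **Notation.** For $\varepsilon_g>0$ let $I_0^\varepsilon(x)=\{i:|x_i|\le\varepsilon_g^{1/2}\}$, $I_{\ne0}^\varepsilon(x)=\{i:|x_i|>\varepsilon_g^{1/2}\}$,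 and let $g^\varepsilon(x)$ have the entries $\nabla_if(x)+\lambda$ if $x_i>\varepsilon_g^{1/2}$, $\nabla_if(x)-\lambda$ if $x_i<-\varepsilon_g^{1/2}$, and $\nabla_if(x)-\min\{\max\{-\lambda-\varepsilon_g^{3/4},\nabla_if(x)\},\lambda+\varepsilon_g^{3/4}\}$ otherwise. A point $x$ is a *weak $\varepsilon_g$-1o point* if $\|g^\varepsilon(x)\|\le\varepsilon_g$. Put ${\rm sgn}(0)=1$ and $\mathcal G_t(x)=t\,(x-{\rm prox}_{\frac\lambda t\|\cdot\|_1}(x-\frac1t\nabla f(x)))$. Subscripts $J$ denote subvectors and principal submatrices. **Method (PGN2CM).** Parameters: $\beta>1$, $\delta\in[0,1]$, $\hat\tau\ge1$, $\zeta,\bar\eta,\theta\in(0,1)$, $\eta\in(0,\frac{1-\zeta}2)$, $0<\varepsilon_g,\varepsilon_h<1$. At $x=x^k$: 1. If $I_0^\varepsilon(x)\neq\emptyset$ and $g^\varepsilon(x)_{I_0^\varepsilon(x)}\ne0$: $x^{k+1}={\rm prox}_{\frac{\lambda}{t}\|\cdot\|_1}(x-\frac1{t}\nabla f(x))$ with $t=\beta^{j}$,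 where $j\ge0$ is the smallest integer for which the value of $\varphi$ at this point is $<\varphi(x)-\frac{\bar\eta}{\beta^j}\|\mathcal G_{\beta^j}(x)\|^2$. 2. Otherwise, if $J:=I_{\ne0}^\varepsilon(x)\ne\emptyset$ and $\|g\|>\varepsilon_g$ for $g:=g^\varepsilon(x)_J$: let $H=(\nabla^2f(x))_J$, choose any $\tau_k\in[2\varepsilon_h\|g\|^{-\delta},2\hat\tau\varepsilon_h\|g\|^{-\delta}]$ and any $M\ge0$, and let $(d,d_{\rm type})$ be the output of the Capped CG method below with $\epsilon=\varepsilon_h$, $\bar\tau=\tau_k$. Set $d^k=0$ off $J$, and $d^k_J=d$ if $d_{\rm type}={\rm SOL}$, $d^k_J=-{\rm sgn}(d^\top g)\frac{|d^\top Hd|}{\|d\|^2}\frac d{\|d\|}$ if $d_{\rm type}={\rm NC}$. Then $x^{k+1}=x+\theta^{j}d^k$ with the smallest integer $j\ge0$ such that $\varphi(x+\theta^jd^k)<\varphi(x)-\eta\theta^{2j}\varepsilon_h\|d^k\|^2$. 3. Otherwise (second phase; this occurs only at weak $\varepsilon_g$-1o points): let $J=\{i:x_i\neq0\}$, let $S$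 be the diagonal matrix with $s_i=1$ if $|x_i|>\varepsilon_g^{1/2}$ and $s_i=x_i$ otherwise, let $B=S_J(\nabla^2f(x))_JS_J$, and let $g(x)_J=(\nabla f(x))_J+\lambda\,{\rm sgn}(x_J)$. A minimum eigenvalue oracle either issues a certificate for $\lambda_{\min}(B)\ge-\varepsilon_h$, and the method stops, or returns a unit vector $u$ with $u^\top Bu\le-\varepsilon_h/2$; then $d^k_J=-{\rm sgn}(g(x)_J^\top S_Ju)\,|u^\top Bu|\,u$, $d^k=0$ off $J$, and $x^{k+1}=x+\theta^jSd^k$ with the smallest integer $j\ge0$ such that $\varphi(x+\theta^jSd^k)<\varphi(x)-\eta\theta^{2j}\|d^k\|^3$. *Capped CG method* (input $H,g,\epsilon,\zeta,\delta,\bar\tau,M$). Let $\bar H=H+\bar\tau\|g\|^\delta I$, $\kappa=(M+\bar\tau\|g\|^\delta)/\epsilon$, $\hat\zeta=\zeta/(3\kappa)$, $\tau=\sqrt\kappa/(\sqrt\kappa+1)$, $T=4\kappa^4/(1-\sqrt\tau)^2$ (always for the current $M$). Run conjugate gradients $y_0=0$, $r_0=g$, $p_0=-g$, $\alpha_j=\|r_j\|^2/p_j^\top\bar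 Hp_j$, $y_{j+1}=y_j+\alpha_jp_j$, $r_{j+1}=r_j+\alpha_j\bar Hp_j$, $p_{j+1}=-r_{j+1}+\frac{\|r_{j+1}\|^2}{\|r_j\|^2}p_j$. If $p_0^\top\bar Hp_0<\epsilon\|p_0\|^2$, return $(p_0,{\rm NC})$; otherwise raise $M$ to $\|Hp_0\|/\|p_0\|$ if this is larger. For $j=1,2,\dots$: raise $M$ to $\|Hv\|/\|v\|$ for $v=p_j,y_j,r_j$ in turn whenever $\|Hv\|>M\|v\|$; then, if $y_j^\top\bar Hy_j<\epsilon\|y_j\|^2$, return $(y_j,{\rm NC})$; else if $\|r_j\|\le\hat\zeta\|r_0\|$, return $(y_j,{\rm SOL})$; else if $p_j^\top\bar Hp_j<\epsilon\|p_j\|^2$, return $(p_j,{\rm NC})$; else if $\|r_j\|>\sqrt T\tau^{j/2}\|r_0\|$, find $i\in\{0,\dots,j-1\}$ such that $d=y_{j+1}-y_i$ satisfies $d^\top\bar Hd<\epsilon\|d\|^2$, and return $(d,{\rm NC})$. **Theorem.** Let $$c_{pg}=\frac{\bar\eta}{\max\{\beta L_g/(2-2\bar\eta),1\}},\qquad c_{nc}=\eta\theta^2\min\Big\{1,\frac{9(1-2\eta)^2}{L_H^2}\Big\},$$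 $$c_{sol}=\eta\min\Big\{\Big(\tfrac{4}{\sqrt{(\zeta+4\hat\tau)^2+8L_H}+\zeta+4\hat\tau}\Big)^2,\ \tfrac{9(1-\zeta-2\eta)^2\theta^2}{L_H^2},\ \theta^2,\ \tfrac{(1-\zeta)^2\theta^2}{4\max\{L_H/3,\,2\eta\}^2}\Big\},$$ $$K=\left\lceil\frac{3(\varphi(x^0)-\varphi_{\rm low})}{\min\{c_{nc},c_{pg},c_{sol}\}}\max\{\varepsilon_g^{-1}\varepsilon_h^{-1},\varepsilon_h^{-3},\varepsilon_g^{-2}\varepsilon_h,\varepsilon_g^{-3/2}\}\right\rceil+2 .$$ Then PGN2CM started at $x^0$ reaches a weak $\varepsilon_g$-1o point in at most $K$ iterations: at every iterate that is not a weak $\varepsilon_g$-1o point, the next iteration is of type 1 or 2 and is well defined (the line searches and the Capped CG method end, whatever choices are made), and among the iterates $x^0,\dots,x^K$ of any $K$ iterations there is a weak $\varepsilon_g$-1o point. In particular, with $0<\varepsilon<1$, $\varepsilon_g=\varepsilon$ and $\varepsilon_h=\varepsilon^{1/2}$, it reaches a weak $\varepsilon$-1o point within $$\left\lceil\frac{3(\varphi(x^0)-\varphi_{\rm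 low})}{\min\{c_{nc},c_{pg},c_{sol}\}}\,\varepsilon^{-3/2}\right\rceil+2$$ iterations. -/

import Mathlib

noncomputable section

namespace PGN2CM

/-- `ℝⁿ` with the Euclidean norm. -/
abbrev E (n : ℕ) : Type := EuclideanSpace ℝ (Fin n)

/-! ## The problem -/

/-- The `ℓ₁`-norm. -/
def l1 {n : ℕ} (x : E n) : ℝ := ∑ i, |x i|

/-- The objective `φ(x) = f(x) + lam * ‖x‖₁`. -/
def obj {n : ℕ} (f : E n → ℝ) (lam : ℝ) (x : E n) : ℝ := f x + lam * l1 x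

/-- The level set `{x | φ(x) ≤ φ(x⁰)}`. -/
def levelSet {n : ℕ} (f : E n → ℝ) (lam : ℝ) (x₀ : E n) : Set (E n) :=
  {x | obj f lam x ≤ obj f lam x₀}

/-- The Hessian `∇²f(x)`, as the derivative of the gradient. -/
def hess {n : ℕ} (f : E n → ℝ) (x : E n) : E n →L[ℝ] E n := fderiv ℝ (gradient f) x

/-- The level set of `x⁰` is bounded; `f` is continuous, and on an open neighbourhood of the level
set it is twice continuously differentiable with Lipschitz Hessian. -/
structure StandingAssumption {n : ℕ} (f : E n → ℝ) (lam : ℝ) (x₀ : E n) : Prop where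
  continuous : Continuous f
  bounded : Bornology.IsBounded (levelSet f lam x₀)
  smooth : ∃ U : Set (E n), IsOpen U ∧ levelSet f lam x₀ ⊆ U ∧ ContDiffOn ℝ 2 f U ∧
    ∃ C : NNReal, LipschitzOnWith C (hess f) U

/-- `Lg` and `LH` are smoothness constants of `f` on the level set of `x⁰`. -/
structure SmoothnessConstants {n : ℕ} (f : E n → ℝ) (lam : ℝ) (x₀ : E n) (Lg LH : ℝ) :
    Prop where
  Lg_pos : 0 < Lg
  LH_pos : 0 < LH
  upper_quadratic : ∀ x ∈ levelSet f lam x₀, ∀ y ∈ levelSet f lam x₀, ∀ L : ℝ, Lg ≤ L →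
    f y ≤ f x + inner ℝ (gradient f x) (y - x) + L / 2 * ‖y - x‖ ^ 2
  gradient_approx : ∀ x ∈ levelSet f lam x₀, ∀ y ∈ levelSet f lam x₀,
    ‖hess f x (y - x) - (gradient f y - gradient f x)‖ ≤ LH / 2 * ‖y - x‖ ^ 2
  upper_cubic : ∀ x ∈ levelSet f lam x₀, ∀ y ∈ levelSet f lam x₀,
    f y ≤ f x + inner ℝ (gradient f x) (y - x) + 1 / 2 * inner ℝ (y - x) (hess f x (y - x))
      + LH / 6 * ‖y - x‖ ^ 3
  hess_le : ∀ x ∈ levelSet f lam x₀, ‖hess f x‖ ≤ Lg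

/-! ## Index sets, subvectors, principal submatrices -/

/-- `{i | |x_i| ≤ εg^{1/2}}` -/
def smallIdx {n : ℕ} (εg : ℝ) (x : E n) : Finset (Fin n) :=
  Finset.univ.filter fun i => |x i| ≤ εg ^ (1 / 2 : ℝ)

/-- `{i | |x_i| > εg^{1/2}}` -/
def bigIdx {n : ℕ} (εg : ℝ) (x : E n) : Finset (Fin n) :=
  Finset.univ.filter fun i => εg ^ (1 / 2 : ℝ) < |x i|

/-- `{i | x_i ≠ 0}` -/
def nzIdx {n : ℕ} (x : E n) : Finset (Fin n) :=
  Finset.univ.filter fun i => x i ≠ 0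

/-- The subvector `x_J`. -/
def sub {n : ℕ} (J : Finset (Fin n)) : E n →ₗ[ℝ] EuclideanSpace ℝ J where
  toFun x := WithLp.toLp 2 fun i => x i
  map_add' _ _ := rfl
  map_smul' _ _ := rfl

/-- Extension of a vector indexed by `J` by zero outside `J`. -/
def ext {n : ℕ} (J : Finset (Fin n)) : EuclideanSpace ℝ J →ₗ[ℝ] E n where
  toFun d := WithLp.toLp 2 fun i => if h : i ∈ J then d ⟨i, h⟩ else 0
  map_add' d e := by
    ext i
    by_cases h : i ∈ J <;> simp [h]
  map_smul' c d := by
    ext i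
    by_cases h : i ∈ J <;> simp [h]

/-- The principal submatrix `A_J`, as an operator. -/
def subOp {n : ℕ} (J : Finset (Fin n)) (A : E n →ₗ[ℝ] E n) :
    EuclideanSpace ℝ J →ₗ[ℝ] EuclideanSpace ℝ J :=
  sub J ∘ₗ A ∘ₗ ext J

/-- The sign, with `sgn 0 = 1`. -/
def sgn (a : ℝ) : ℝ := if 0 ≤ a then 1 else -1

/-! ## First-order quantities -/

/-- The minimum norm element `g(x)` of `∇f(x) + lam * ∂‖x‖₁`. -/
def gVec {n : ℕ} (f : E n → ℝ) (lam : ℝ) (x : E n) : E n :=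
  WithLp.toLp 2 fun i =>
    if 0 < x i then gradient f x i + lam
    else if x i < 0 then gradient f x i - lam
    else gradient f x i - min (max (-lam) (gradient f x i)) lam

/-- The relaxed vector `g^ε(x)`. -/
def gEps {n : ℕ} (f : E n → ℝ) (lam εg : ℝ) (x : E n) : E n :=
  WithLp.toLp 2 fun i =>
    if εg ^ (1 / 2 : ℝ) < x i then gradient f x i + lam
    else if x i < -εg ^ (1 / 2 : ℝ) then gradient f x i - lam
    else gradient f x i -
      min (max (-lam - εg ^ (3 / 4 : ℝ)) (gradient f x i)) (lam + εg ^ (3 / 4 : ℝ))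

/-- Weak `εg`-first-order points. -/
def IsWeakFirstOrder {n : ℕ} (f : E n → ℝ) (lam εg : ℝ) (x : E n) : Prop :=
  ‖gEps f lam εg x‖ ≤ εg

/-- `p = prox_h(z)`, that is, `p` minimizes `y ↦ h(y) + ½‖y - z‖²`. -/
def IsProx {n : ℕ} (h : E n → ℝ) (z p : E n) : Prop :=
  ∀ y, h p + 1 / 2 * ‖p - z‖ ^ 2 ≤ h y + 1 / 2 * ‖y - z‖ ^ 2

/-- The proximal mapping of `μ * ‖·‖₁` (soft thresholding, see `isProx_iff`). -/
def proxL1 {n : ℕ} (μ : ℝ) (z : E n) : E n :=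
  WithLp.toLp 2 fun i => if μ < z i then z i - μ else if z i < -μ then z i + μ else 0

theorem soft_ineq (μ a b : ℝ) (hμ : 0 ≤ μ) (p : ℝ)
    (hp : p = if μ < a then a - μ else if a < -μ then a + μ else 0) :
    μ * |p| + 1 / 2 * (p - a) ^ 2 + 1 / 2 * (b - p) ^ 2 ≤ μ * |b| + 1 / 2 * (b - a) ^ 2 := by
  have h1 : μ * b ≤ μ * |b| := mul_le_mul_of_nonneg_left (le_abs_self b) hμ
  have h2 : μ * (-b) ≤ μ * |b| := mul_le_mul_of_nonneg_left (neg_le_abs b) hμ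
  split_ifs at hp with h h'
  · rw [abs_of_pos (by linarith : 0 < p)]; subst hp; nlinarith
  · rw [abs_of_neg (by linarith : p < 0)]; subst hp; nlinarith
  · subst hp
    have h3 : a * b ≤ μ * |b| := by
      refine (le_abs_self _).trans ?_
      rw [abs_mul]
      exact mul_le_mul_of_nonneg_right (abs_le.2 ⟨by linarith, by linarith⟩) (abs_nonneg b)
    simp only [abs_zero]
    nlinarith

theorem proxL1_ineq {n : ℕ} {μ : ℝ} (hμ : 0 ≤ μ) (z y : E n) :
    μ * l1 (proxL1 μ z) + 1 / 2 * ‖proxL1 μ z - z‖ ^ 2 + 1 / 2 * ‖y - proxL1 μ z‖ ^ 2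
      ≤ μ * l1 y + 1 / 2 * ‖y - z‖ ^ 2 := by
  simp only [EuclideanSpace.real_norm_sq_eq, l1, Finset.mul_sum, ← Finset.sum_add_distrib]
  exact Finset.sum_le_sum fun i _ => soft_ineq μ (z i) (y i) hμ _ rfl

/-- Soft thresholding is the proximal mapping of `μ * ‖·‖₁`. -/
theorem isProx_iff {n : ℕ} {μ : ℝ} (hμ : 0 ≤ μ) (z p : E n) :
    IsProx (fun y => μ * l1 y) z p ↔ p = proxL1 μ z := by
  constructor
  · intro h
    have h1 := h (proxL1 μ z)
    have h2 := proxL1_ineq hμ z p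
    have h3 : ‖p - proxL1 μ z‖ ^ 2 = 0 :=
      le_antisymm (by linarith) (sq_nonneg _)
    exact sub_eq_zero.1 (norm_eq_zero.1 (pow_eq_zero_iff two_ne_zero |>.1 h3))
  · rintro rfl y
    have h2 := proxL1_ineq hμ z y
    have h3 := sq_nonneg ‖y - proxL1 μ z‖
    linarith

/-- The proximal gradient point `prox_{(lam/t)‖·‖₁}(x - (1/t)∇f(x))`. -/
def proxPoint {n : ℕ} (f : E n → ℝ) (lam t : ℝ) (x : E n) : E n :=
  proxL1 (lam / t) (x - (1 / t) • gradient f x)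

/-- The gradient mapping `𝒢_t(x)`. -/
def gradMap {n : ℕ} (f : E n → ℝ) (lam t : ℝ) (x : E n) : E n :=
  t • (x - proxPoint f lam t x)

/-! ## The Capped CG method -/

section CappedCG

variable {V : Type} [NormedAddCommGroup V] [InnerProductSpace ℝ V]

/-- The vectors `y_j, r_j, p_j` of the conjugate gradient iteration. -/
structure CGState (V : Type) where
  y : V
  r : V
  p : V

/-- One conjugate gradient iteration for `Hb y = -g`. -/
def cgStep (Hb : V →ₗ[ℝ] V) (s : CGState V) : CGState V :=
  let α : ℝ := inner ℝ s.r s.r / inner ℝ s.p (Hb s.p)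
  let r' : V := s.r + α • Hb s.p
  let β : ℝ := inner ℝ r' r' / inner ℝ s.r s.r
  { y := s.y + α • s.p, r := r', p := -r' + β • s.p }

/-- The `j`-th conjugate gradient iterate. -/
def cgIter (Hb : V →ₗ[ℝ] V) (g : V) : ℕ → CGState V
  | 0 => { y := 0, r := g, p := -g }
  | j + 1 => cgStep Hb (cgIter Hb g j)

/-- Replace `M` by `‖H v‖ / ‖v‖` if this is larger. -/
def raiseM (H : V →ₗ[ℝ] V) (M : ℝ) (v : V) : ℝ :=
  if M * ‖v‖ < ‖H v‖ then ‖H v‖ / ‖v‖ else M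

/-- The value of the norm estimate `M` when the tests of iteration `j` are carried out. -/
def ccgM (H Hb : V →ₗ[ℝ] V) (g : V) (M₀ : ℝ) : ℕ → ℝ
  | 0 => raiseM H M₀ (cgIter Hb g 0).p
  | j + 1 =>
    raiseM H (raiseM H (raiseM H (ccgM H Hb g M₀ j) (cgIter Hb g (j + 1)).p)
      (cgIter Hb g (j + 1)).y) (cgIter Hb g (j + 1)).r

/-- The type of the direction returned by the Capped CG method. -/
inductive DType
  | SOL
  | NC

/-- The input of the Capped CG method: operator `H`, vector `g`, tolerance `ε`, accuracy `ζ`,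
the shift `c = τ̄ ‖g‖^δ` and the initial norm estimate `M₀`. -/
structure CCGInput (V : Type) [NormedAddCommGroup V] [InnerProductSpace ℝ V] where
  H : V →ₗ[ℝ] V
  g : V
  ε : ℝ
  ζ : ℝ
  c : ℝ
  M₀ : ℝ

namespace CCGInput

variable (I : CCGInput V)

/-- The shifted operator `H + c * id`. -/
def Hb : V →ₗ[ℝ] V := I.H + I.c • LinearMap.id

def y (j : ℕ) : V := (cgIter I.Hb I.g j).y

def r (j : ℕ) : V := (cgIter I.Hb I.g j).r

def p (j : ℕ) : V := (cgIter I.Hb I.g j).p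

def kappa (j : ℕ) : ℝ := (ccgM I.H I.Hb I.g I.M₀ j + I.c) / I.ε

def zetaHat (j : ℕ) : ℝ := I.ζ / (3 * I.kappa j)

def tau (j : ℕ) : ℝ := √(I.kappa j) / (√(I.kappa j) + 1)

def T (j : ℕ) : ℝ := 4 * I.kappa j ^ 4 / (1 - √(I.tau j)) ^ 2

/-- `⟨v, Hb v⟩ < ε ‖v‖²` -/
def LowCurv (v : V) : Prop := inner ℝ v (I.Hb v) < I.ε * ‖v‖ ^ 2

def SmallRes (j : ℕ) : Prop := ‖I.r j‖ ≤ I.zetaHat j * ‖I.r 0‖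

def SlowDecay (j : ℕ) : Prop :=
  √(I.T j) * I.tau j ^ ((j : ℝ) / 2) * ‖I.r 0‖ < ‖I.r j‖

/-- None of the tests of iteration `j` fires, so that the loop goes on. -/
def Continues (j : ℕ) : Prop :=
  if j = 0 then ¬ I.LowCurv (I.p 0)
  else ¬ I.LowCurv (I.y j) ∧ ¬ I.SmallRes j ∧ ¬ I.LowCurv (I.p j) ∧ ¬ I.SlowDecay j

open Classical in
/-- The tests of iteration `j`, carried out in this order, end the method with output `(d, ty)`. -/
def Exits (j : ℕ) (d : V) (ty : DType) : Prop :=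
  if j = 0 then I.LowCurv (I.p 0) ∧ d = I.p 0 ∧ ty = DType.NC
  else if I.LowCurv (I.y j) then d = I.y j ∧ ty = DType.NC
  else if I.SmallRes j then d = I.y j ∧ ty = DType.SOL
  else if I.LowCurv (I.p j) then d = I.p j ∧ ty = DType.NC
  else if I.SlowDecay j then
    ∃ i < j, I.LowCurv (I.y (j + 1) - I.y i) ∧ d = I.y (j + 1) - I.y i ∧ ty = DType.NC
  else False

/-- `(d, ty)` is a possible output of the Capped CG method. The only freedom is the choice of the
index `i` in the last test. -/
def Returns (d : V) (ty : DType) : Prop :=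
  ∃ j, (∀ l < j, I.Continues l) ∧ I.Exits j d ty

end CCGInput

end CappedCG

/-! ## The proximal gradient-Newton-CG method -/

/-- The parameters of the method, apart from the two tolerances. -/
structure Params where
  β : ℝ
  δ : ℝ
  τhat : ℝ
  ζ : ℝ
  ηbar : ℝ
  η : ℝ
  θ : ℝ
  one_lt_β : 1 < β
  δ_mem : δ ∈ Set.Icc (0 : ℝ) 1
  one_le_τhat : 1 ≤ τhat
  ζ_mem : ζ ∈ Set.Ioo (0 : ℝ) 1
  ηbar_mem : ηbar ∈ Set.Ioo (0 : ℝ) 1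
  η_mem : η ∈ Set.Ioo (0 : ℝ) ((1 - ζ) / 2)
  θ_mem : θ ∈ Set.Ioo (0 : ℝ) 1

section Method

variable {n : ℕ} (f : E n → ℝ) (lam εg εh : ℝ) (P : Params)

/-- The method takes a proximal gradient step at `x`. -/
def ProxBranch (x : E n) : Prop :=
  (smallIdx εg x).Nonempty ∧ ‖sub (smallIdx εg x) (gEps f lam εg x)‖ ≠ 0

/-- The method takes a Newton-CG step at `x`. -/
def NewtonBranch (x : E n) : Prop :=
  ¬ ProxBranch f lam εg x ∧
    (bigIdx εg x).Nonempty ∧ εg < ‖sub (bigIdx εg x) (gEps f lam εg x)‖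

/-- The line search condition of the proximal gradient step. -/
def ProxSearch (x : E n) (j : ℕ) : Prop :=
  obj f lam (proxPoint f lam (P.β ^ j) x)
    < obj f lam x - P.ηbar / P.β ^ j * ‖gradMap f lam (P.β ^ j) x‖ ^ 2

def ProxStep (x x' : E n) : Prop :=
  ∃ j, IsLeast {j | ProxSearch f lam P x j} j ∧ x' = proxPoint f lam (P.β ^ j) x

/-- The input with which the Capped CG method is called at `x`, for a regularization factor `τ`
and a norm estimate `M`. -/
def newtonInput (x : E n) (τ M : ℝ) : CCGInput (EuclideanSpace ℝ (bigIdx εg x)) where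
  H := subOp (bigIdx εg x) (hess f x).toLinearMap
  g := sub (bigIdx εg x) (gEps f lam εg x)
  ε := εh
  ζ := P.ζ
  c := τ * ‖sub (bigIdx εg x) (gEps f lam εg x)‖ ^ P.δ
  M₀ := M

/-- The admissible regularization factors at `x`. -/
def tauRange (x : E n) : Set ℝ :=
  Set.Icc (2 * εh / ‖sub (bigIdx εg x) (gEps f lam εg x)‖ ^ P.δ)
    (2 * P.τhat * εh / ‖sub (bigIdx εg x) (gEps f lam εg x)‖ ^ P.δ)

/-- The search direction of the Newton-CG step, from the output `(d, ty)` of Capped CG. -/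
def newtonDir (x : E n) (d : EuclideanSpace ℝ (bigIdx εg x)) : DType → E n
  | DType.SOL => ext (bigIdx εg x) d
  | DType.NC => ext (bigIdx εg x)
      ((-sgn (inner ℝ d (sub (bigIdx εg x) (gEps f lam εg x))) *
        (|inner ℝ d (subOp (bigIdx εg x) (hess f x).toLinearMap d)| / ‖d‖ ^ 2)) • ((1 / ‖d‖) • d))

/-- The line search condition of the Newton-CG step with direction `d`. -/
def NewtonSearch (x d : E n) (j : ℕ) : Prop :=
  obj f lam (x + P.θ ^ j • d) < obj f lam x - P.η * P.θ ^ (2 * j) * εh * ‖d‖ ^ 2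

def NewtonStep (x x' : E n) : Prop :=
  ∃ τ ∈ tauRange f lam εg εh P x, ∃ M : ℝ, 0 ≤ M ∧ ∃ d ty,
    (newtonInput f lam εg εh P x τ M).Returns d ty ∧
    ∃ j, IsLeast {j | NewtonSearch f lam εh P x (newtonDir f lam εg x d ty) j} j ∧
      x' = x + P.θ ^ j • newtonDir f lam εg x d ty

/-- The diagonal scaling `S`, with `s_i = 1` if `|x_i| > εg^{1/2}` and `s_i = x_i` otherwise. -/
def scaling (x : E n) : E n →ₗ[ℝ] E n where
  toFun v := WithLp.toLp 2 fun i => (if εg ^ (1 / 2 : ℝ) < |x i| then 1 else x i) * v i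
  map_add' v w := by
    ext i
    simp [mul_add]
  map_smul' c v := by
    ext i
    simp [mul_left_comm]

/-- The scaled Hessian restricted to the nonzero coordinates. -/
def scaledHess (x : E n) : EuclideanSpace ℝ (nzIdx x) →ₗ[ℝ] EuclideanSpace ℝ (nzIdx x) :=
  subOp (nzIdx x) (scaling εg x ∘ₗ (hess f x).toLinearMap ∘ₗ scaling εg x)

/-- The direction of the negative curvature step of the second phase, for a vector `u`. -/
def curvDir (x : E n) (u : EuclideanSpace ℝ (nzIdx x)) : E n :=
  ext (nzIdx x) ((-sgn (inner ℝ (sub (nzIdx x) (gVec f lam x)) (subOp (nzIdx x) (scaling εg x) u)) *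
    |inner ℝ u (scaledHess f εg x u)|) • u)

/-- The negative curvature step of the second phase: the minimum eigenvalue oracle has returned a
unit vector `u` of curvature at most `-εh / 2`. If the oracle issues a certificate instead, the
method stops, and there is no further iterate. -/
def CurvStep (x x' : E n) : Prop :=
  ∃ u : EuclideanSpace ℝ (nzIdx x), ‖u‖ = 1 ∧ inner ℝ u (scaledHess f εg x u) ≤ -(εh / 2) ∧
    ∃ j, IsLeast {j | obj f lam (x + P.θ ^ j • scaling εg x (curvDir f lam εg x u))
        < obj f lam x - P.η * P.θ ^ (2 * j) * ‖curvDir f lam εg x u‖ ^ 3} j ∧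
      x' = x + P.θ ^ j • scaling εg x (curvDir f lam εg x u)

/-- One iteration of the method leads from `x` to `x'`. -/
def Step (x x' : E n) : Prop :=
  (ProxBranch f lam εg x ∧ ProxStep f lam P x x') ∨
  (NewtonBranch f lam εg x ∧ NewtonStep f lam εg εh P x x') ∨
  (¬ ProxBranch f lam εg x ∧ ¬ NewtonBranch f lam εg x ∧ CurvStep f lam εg εh P x x')

/-- `x 0, …, x N` are the iterates of `N` iterations of the method started at `x₀`. -/
def IsRun (x₀ : E n) (N : ℕ) (x : ℕ → E n) : Prop :=
  x 0 = x₀ ∧ ∀ k < N, Step f lam εg εh P (x k) (x (k + 1))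

/-- At `x` the method performs an iteration of its first phase, and this iteration succeeds whatever
admissible choices are made in it: the line searches end, and so does the Capped CG method. -/
def FirstPhaseIterationSucceeds (x : E n) : Prop :=
  (ProxBranch f lam εg x ∧ ∃ j, ProxSearch f lam P x j) ∨
  (NewtonBranch f lam εg x ∧ ∀ τ ∈ tauRange f lam εg εh P x, ∀ M : ℝ, 0 ≤ M →
    (∃ d ty, (newtonInput f lam εg εh P x τ M).Returns d ty) ∧
    ∀ d ty, (newtonInput f lam εg εh P x τ M).Returns d ty →
      ∃ j, NewtonSearch f lam εh P x (newtonDir f lam εg x d ty) j)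

/-- The method, started at `x₀`, reaches a weak `εg`-first-order point in at most `K` iterations:
as long as the current iterate is not such a point, the next iteration is well defined, and among
the iterates of `K` iterations there is such a point. -/
def ReachesWithin (x₀ : E n) (K : ℕ) : Prop :=
  (∀ (N : ℕ) (x : ℕ → E n), IsRun f lam εg εh P x₀ N x → ¬ IsWeakFirstOrder f lam εg (x N) →
    FirstPhaseIterationSucceeds f lam εg εh P (x N)) ∧
  ∀ x : ℕ → E n, IsRun f lam εg εh P x₀ K x → ∃ k ≤ K, IsWeakFirstOrder f lam εg (x k)

end Method

/-! ## The constants -/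

def cPG (P : Params) (Lg : ℝ) : ℝ := P.ηbar / max (P.β * Lg / (2 - 2 * P.ηbar)) 1

def cNC (P : Params) (LH : ℝ) : ℝ :=
  P.η * P.θ ^ 2 * min 1 (9 * (1 - 2 * P.η) ^ 2 / LH ^ 2)

def cSOL (P : Params) (LH : ℝ) : ℝ :=
  P.η * min
    (min ((4 / (√((P.ζ + 4 * P.τhat) ^ 2 + 8 * LH) + (P.ζ + 4 * P.τhat))) ^ 2)
      (9 * (1 - P.ζ - 2 * P.η) ^ 2 * P.θ ^ 2 / LH ^ 2))
    (min (P.θ ^ 2) ((1 - P.ζ) ^ 2 * P.θ ^ 2 / (4 * max (LH / 3) (2 * P.η) ^ 2)))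

/-- `min {c_nc, c_pg, c_sol}` -/
def cMin (P : Params) (Lg LH : ℝ) : ℝ := min (cNC P LH) (min (cPG P Lg) (cSOL P LH))

end PGN2CM

end

/-! The argument is a descent count. Outside weak first-order points,
`branch_of_not_isWeakFirstOrder` excludes the second phase. Let `q` be `cMin` times `progress`, the
minimum of `εg εh`, `εh ^ 3`, `εg ^ 2 / εh` and `εg ^ (3/2)`. A proximal gradient step lowers the
objective by at least `q`, because a nonzero small component of `gEps` forces the gradient mapping
to have norm at least `εg ^ (3/4)` (`le_norm_gradMap`).

A Newton-CG step lowers it by about `εh` times the squared step length. That length is bounded below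
if the line search backtracked (`IsDescentDir.decrease`), if the direction has negative curvature,
or if a unit step is longer than `√εg`. A shorter unit Newton step changes no sign and leaves a
gradient bounded by its length (`norm_gEps_unit_step_le`); so if the next iteration is again a
Newton step, the gradient there exceeds `εg` and the step was long enough after all. If instead a
proximal step follows, that step pays. Hence any two consecutive first-phase iterations gain `q`
(`two_steps_decrease`), and the gap to the minimum limits the number of disjoint pairs
(`reachesWithin`).

Two points need care. The smoothness constants hold only on the level set, so trial points must
first be shown to lie in it: along the path of trial points, the descent estimate makes the value
strictly smaller wherever it is at most `φ(x⁰)`, so by continuity the path cannot leave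
(`le_of_forall_lt_of_le`). Capped CG must also terminate: nonzero orthogonal residuals cannot go on
forever in finite dimension, and an estimate-sequence argument shows that slow decay of the
residuals produces a difference of iterates with low curvature (`cg_residual_decay`). -/

noncomputable section

namespace PGN2CM

/-! ### Taylor estimates near the level set and existence of the smoothness constants. -/

section Smoothness

variable {n : ℕ} {f : E n → ℝ} {lam : ℝ} {x₀ x : E n}

theorem contDiffAt_gradient (h : ContDiffAt ℝ 2 f x) : ContDiffAt ℝ 1 (gradient f) x := by
  have h1 : ContDiffAt ℝ 1 (fderiv ℝ f) x := h.fderiv_right (by norm_num)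
  exact (InnerProductSpace.toDual ℝ (E n)).symm.toContinuousLinearEquiv.contDiff.contDiffAt.comp x h1

theorem hasFDerivAt_gradient (h : ContDiffAt ℝ 2 f x) :
    HasFDerivAt (gradient f) (hess f x) x :=
  ((contDiffAt_gradient h).differentiableAt (by norm_num)).hasFDerivAt

theorem hasFDerivAt_inner_gradient (h : ContDiffAt ℝ 2 f x) :
    HasFDerivAt f (innerSL ℝ (gradient f x)) x :=
  (h.differentiableAt (by norm_num)).hasGradientAt.hasFDerivAt

/-- Symmetry of the second derivative, carried over by the Riesz isomorphism. -/
theorem inner_hess_comm (h : ContDiffAt ℝ 2 f x) (v w : E n) :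
    inner ℝ (hess f x v) w = inner ℝ v (hess f x w) := by
  have h1 : DifferentiableAt ℝ (fderiv ℝ f) x :=
    (h.fderiv_right (m := 1) (by norm_num)).differentiableAt (by norm_num)
  have key : ∀ v w : E n, inner ℝ (hess f x v) w = fderiv ℝ (fderiv ℝ f) x v w := by
    intro v w
    have h2 : HasFDerivAt (gradient f)
        ((InnerProductSpace.toDual ℝ (E n)).symm.toContinuousLinearEquiv.toContinuousLinearMap.comp
          (fderiv ℝ (fderiv ℝ f) x)) x :=
      (InnerProductSpace.toDual ℝ (E n)).symm.toContinuousLinearEquiv.hasFDerivAt.comp x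
        h1.hasFDerivAt
    rw [hess, h2.fderiv]
    exact InnerProductSpace.toDual_symm_apply
  rw [key v w, (h.isSymmSndFDerivAt (by simp)) v w, ← key w v, real_inner_comm]

/-- The mean value inequality is applied on the ball of radius `‖y - x‖`, to the gradient and then
to the second-order remainder. This loses the factors 1/2 and 1/6 of integration, which is harmless
because only some constant is needed. -/
theorem taylor_of_hess_lipschitz {r C : ℝ}
    (hf : ∀ z ∈ Metric.ball x r, ContDiffAt ℝ 2 f z)
    (hC : ∀ z ∈ Metric.ball x r, ‖hess f z - hess f x‖ ≤ C * ‖z - x‖) (hC0 : 0 ≤ C)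
    {y : E n} (hy : y ∈ Metric.ball x r) :
    ‖hess f x (y - x) - (gradient f y - gradient f x)‖ ≤ C * ‖y - x‖ ^ 2 ∧
    |f y - f x - inner ℝ (gradient f x) (y - x) - 1 / 2 * inner ℝ (y - x) (hess f x (y - x))|
      ≤ C * ‖y - x‖ ^ 3 := by
  have hsub : ∀ y ∈ Metric.ball x r, ∀ z ∈ Metric.closedBall x ‖y - x‖, z ∈ Metric.ball x r := by
    intro y hy z hz
    rw [mem_ball_iff_norm] at *
    rw [mem_closedBall_iff_norm] at hz
    exact hz.trans_lt hy
  have h1 : ∀ y ∈ Metric.ball x r,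
      ‖gradient f y - gradient f x - hess f x (y - x)‖ ≤ C * ‖y - x‖ ^ 2 := by
    intro y hy
    have := (convex_closedBall x ‖y - x‖).norm_image_sub_le_of_norm_hasFDerivWithin_le'
      (f := gradient f) (f' := hess f) (φ := hess f x) (C := C * ‖y - x‖) (x := x) (y := y)
      (fun z hz => (hasFDerivAt_gradient (hf z (hsub y hy z hz))).hasFDerivWithinAt)
      (fun z hz => (hC z (hsub y hy z hz)).trans
        (mul_le_mul_of_nonneg_left (mem_closedBall_iff_norm.1 hz) hC0))
      (Metric.mem_closedBall_self (norm_nonneg _)) (mem_closedBall_iff_norm.2 le_rfl)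
    rwa [mul_assoc, ← sq] at this
  refine ⟨by rw [norm_sub_rev]; exact h1 y hy, ?_⟩
  have hx : ContDiffAt ℝ 2 f x :=
    hf x (Metric.mem_ball_self (dist_nonneg.trans_lt (Metric.mem_ball.1 hy)))
  -- By symmetry of the Hessian, the gradient of `k` is the first-order remainder of `gradient f`,
  -- already bounded in `h1`.
  let k : E n → ℝ := fun z => f z - inner ℝ (gradient f x) (z - x)
    - 1 / 2 * inner ℝ (z - x) (hess f x (z - x))
  have hk : ∀ z ∈ Metric.ball x r, HasFDerivAt k
      (innerSL ℝ (gradient f z - gradient f x - hess f x (z - x))) z := by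
    intro z hz
    have e1 : HasFDerivAt (fun z : E n => z - x) (ContinuousLinearMap.id ℝ (E n)) z :=
      (hasFDerivAt_id z).sub_const x
    have e2 := (hess f x).hasFDerivAt.comp z e1
    have e3 := ((hasFDerivAt_inner_gradient (hf z hz)).sub
      ((hasFDerivAt_const (gradient f x) z).inner ℝ e1)).sub
      ((e1.inner ℝ e2).const_mul (1 / 2))
    refine e3.congr_fderiv ?_
    ext v
    simp only [map_sub, innerSL_apply_apply, sub_apply, ContinuousLinearMap.comp_apply,
      ContinuousLinearMap.prod_apply, ContinuousLinearMap.id_apply, zero_apply,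
      smul_apply, fderivInnerCLM_apply, Function.comp_apply, inner_zero_left,
      inner_sub_left, inner_sub_right, smul_eq_mul, inner_hess_comm hx z v, inner_hess_comm hx x v]
    rw [real_inner_comm _ v, real_inner_comm _ v, inner_hess_comm hx z v, inner_hess_comm hx x v]
    ring
  have := (convex_closedBall x ‖y - x‖).norm_image_sub_le_of_norm_hasFDerivWithin_le
      (f := k) (C := C * ‖y - x‖ ^ 2) (x := x) (y := y)
      (fun z hz => (hk z (hsub y hy z hz)).hasFDerivWithinAt)
      (fun z hz => by
        rw [innerSL_apply_norm]
        refine (h1 z (hsub y hy z hz)).trans (mul_le_mul_of_nonneg_left ?_ hC0)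
        exact pow_le_pow_left₀ (norm_nonneg _) (mem_closedBall_iff_norm.1 hz) 2)
      (Metric.mem_closedBall_self (norm_nonneg _)) (mem_closedBall_iff_norm.2 le_rfl)
  simp only [k, sub_self, map_zero, inner_zero_right, mul_zero, sub_zero, Real.norm_eq_abs] at this
  calc _ = _ := by congr 1; ring
    _ ≤ _ := this
    _ = _ := by ring

theorem continuous_l1 : Continuous (l1 : E n → ℝ) := by
  unfold l1; fun_prop

theorem StandingAssumption.continuous_obj (hf : StandingAssumption f lam x₀) :
    Continuous (obj f lam) :=
  hf.continuous.add (continuous_const.mul continuous_l1)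

theorem StandingAssumption.isCompact_levelSet (hf : StandingAssumption f lam x₀) :
    IsCompact (levelSet f lam x₀) :=
  Metric.isCompact_of_isClosed_isBounded
    (isClosed_le hf.continuous_obj continuous_const) hf.bounded

theorem StandingAssumption.contDiffAt (hf : StandingAssumption f lam x₀)
    (hx : x ∈ levelSet f lam x₀) : ContDiffAt ℝ 2 f x := by
  obtain ⟨U, hU, hLU, hfU, -⟩ := hf.smooth
  exact hfU.contDiffAt (hU.mem_nhds (hLU hx))

/-- Second order Taylor estimates, uniform near the level set. -/
theorem StandingAssumption.taylor_near (hf : StandingAssumption f lam x₀) :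
    ∃ δ C : ℝ, 0 < δ ∧ 0 ≤ C ∧ ∀ x ∈ levelSet f lam x₀, ∀ y, ‖y - x‖ < δ →
      ‖hess f x (y - x) - (gradient f y - gradient f x)‖ ≤ C * ‖y - x‖ ^ 2 ∧
      |f y - f x - inner ℝ (gradient f x) (y - x) - 1 / 2 * inner ℝ (y - x) (hess f x (y - x))|
        ≤ C * ‖y - x‖ ^ 3 := by
  obtain ⟨U, hU, hLU, hfU, C, hC⟩ := hf.smooth
  -- Compactness makes the radius independent of the point of the level set.
  obtain ⟨δ, hδ, hδU⟩ := hf.isCompact_levelSet.exists_thickening_subset_open hU hLU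
  refine ⟨δ, C, hδ, C.2, fun x hx y hy => ?_⟩
  have hball : Metric.ball x δ ⊆ U := (Metric.ball_subset_thickening hx δ).trans hδU
  refine taylor_of_hess_lipschitz (r := δ)
    (fun z hz => hfU.contDiffAt (hU.mem_nhds (hball hz))) (fun z hz => ?_) C.2
    (mem_ball_iff_norm.2 hy)
  have := hC.dist_le_mul z (hball hz) x (hLU hx)
  rwa [dist_eq_norm, dist_eq_norm] at this

/-- The level set need not be convex, so a segment between two of its points may leave the region of
smoothness. Pairs closer than `δ` are handled by Taylor; for the others every error is bounded by
compactness, and a bounded quantity is at most a multiple of `‖y - x‖ ^ m` once `‖y - x‖ ≥ δ`. -/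
theorem StandingAssumption.exists_smoothnessConstants (hf : StandingAssumption f lam x₀) :
    ∃ Lg LH : ℝ, SmoothnessConstants f lam x₀ Lg LH := by
  obtain ⟨δ, C, hδ, hC, hnear⟩ := hf.taylor_near
  have hK := hf.isCompact_levelSet
  have hcg : ContinuousOn (gradient f) (levelSet f lam x₀) := fun x hx =>
    (contDiffAt_gradient (hf.contDiffAt hx)).continuousAt.continuousWithinAt
  have hch : ContinuousOn (hess f) (levelSet f lam x₀) := fun x hx =>
    ((contDiffAt_gradient (hf.contDiffAt hx)).fderiv_right (m := 0)
      (by norm_num)).continuousAt.continuousWithinAt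
  obtain ⟨F, hF⟩ := hK.exists_bound_of_continuousOn hf.continuous.continuousOn
  obtain ⟨G, hG⟩ := hK.exists_bound_of_continuousOn hcg
  obtain ⟨B, hB⟩ := hK.exists_bound_of_continuousOn hch
  obtain ⟨D, hD⟩ := hK.exists_bound_of_continuousOn continuousOn_id
  simp only [Real.norm_eq_abs, id] at hF hD
  have hz : x₀ ∈ levelSet f lam x₀ := le_refl (obj f lam x₀)
  have hF0 := (abs_nonneg _).trans (hF x₀ hz)
  have hG0 := (norm_nonneg _).trans (hG x₀ hz)
  have hB0 := (norm_nonneg _).trans (hB x₀ hz)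
  have hD0 := (norm_nonneg _).trans (hD x₀ hz)
  have hdist : ∀ x ∈ levelSet f lam x₀, ∀ y ∈ levelSet f lam x₀, ‖y - x‖ ≤ 2 * D := fun x hx y hy =>
    (norm_sub_le _ _).trans (by linarith [hD x hx, hD y hy])
  have hgr : ∀ x ∈ levelSet f lam x₀, ∀ v : E n, |inner ℝ (gradient f x) v| ≤ G * ‖v‖ :=
    fun x hx v => (abs_real_inner_le_norm _ _).trans
      (mul_le_mul_of_nonneg_right (hG x hx) (norm_nonneg _))
  have hhv : ∀ x ∈ levelSet f lam x₀, ∀ v : E n, ‖hess f x v‖ ≤ B * ‖v‖ := fun x hx v =>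
    ((hess f x).le_opNorm v).trans (mul_le_mul_of_nonneg_right (hB x hx) (norm_nonneg _))
  have hhq : ∀ x ∈ levelSet f lam x₀, ∀ v : E n, |inner ℝ v (hess f x v)| ≤ B * ‖v‖ ^ 2 :=
    fun x hx v => (abs_real_inner_le_norm _ _).trans (by
      have := mul_le_mul_of_nonneg_left (hhv x hx v) (norm_nonneg v)
      linarith)
  -- Worst-case errors for distant pairs, from the bounds `F`, `G`, `B` on function, gradient and
  -- Hessian and the diameter bound `2 * D`. The leading 2, 2, 6 cancel the divisors in `L / 2`, `LH
  -- / 2`, `LH / 6`.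
  let A1 := 2 * (2 * F + G * (2 * D)) / δ ^ 2
  let A2 := 2 * (B * (2 * D) + 2 * G) / δ ^ 2
  let A3 := 6 * (2 * F + G * (2 * D) + 1 / 2 * (B * (2 * D) ^ 2)) / δ ^ 3
  have hA1 : 0 ≤ A1 := by positivity
  have hA2 : 0 ≤ A2 := by positivity
  have hA3 : 0 ≤ A3 := by positivity
  have far : ∀ {a A s : ℝ} (m : ℕ), 0 ≤ A → δ ≤ s → a ≤ A → a ≤ A / δ ^ m * s ^ m := by
    intro a A s m hA hs ha
    have : δ ^ m ≤ s ^ m := pow_le_pow_left₀ hδ.le hs m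
    have h2 : A / δ ^ m * δ ^ m = A := div_mul_cancel₀ _ (by positivity)
    have h3 : A / δ ^ m * δ ^ m ≤ A / δ ^ m * s ^ m :=
      mul_le_mul_of_nonneg_left this (by positivity)
    linarith
  refine ⟨B + 2 * (C * δ) + A1 + 1, 6 * C + A2 + A3 + 1, by positivity, by positivity,
    ?_, ?_, ?_, ?_⟩
  · intro x hx y hy L hL
    have hv := norm_nonneg (y - x)
    have h2 : (B + 2 * (C * δ) + A1 + 1) / 2 * ‖y - x‖ ^ 2 ≤ L / 2 * ‖y - x‖ ^ 2 := by
      gcongr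
    refine le_trans ?_ (add_le_add_right h2 _)
    rcases lt_or_ge ‖y - x‖ δ with h | h
    · have h3 := (abs_le.1 (hnear x hx y h).2).2
      have h4 := (abs_le.1 (hhq x hx (y - x))).2
      have h5 : C * ‖y - x‖ ^ 3 ≤ C * δ * ‖y - x‖ ^ 2 := by
        rw [mul_assoc]
        refine mul_le_mul_of_nonneg_left ?_ hC
        nlinarith [sq_nonneg ‖y - x‖]
      nlinarith [mul_nonneg hA1 (sq_nonneg ‖y - x‖), sq_nonneg ‖y - x‖]
    · have h3 := (abs_le.1 (hgr x hx (y - x))).1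
      have h4 := mul_le_mul_of_nonneg_left (hdist x hx y hy) hG0
      have h6 := far (a := 2 * (f y - f x - inner ℝ (gradient f x) (y - x)))
        (A := 2 * (2 * F + G * (2 * D))) 2 (by positivity) h
        (by linarith [(abs_le.1 (hF x hx)).1, (abs_le.1 (hF y hy)).2])
      have h7 : 0 ≤ (B + 2 * (C * δ) + 1) * ‖y - x‖ ^ 2 := by positivity
      change _ ≤ A1 * _ at h6
      linarith
  · intro x hx y hy
    rcases lt_or_ge ‖y - x‖ δ with h | h
    · refine (hnear x hx y h).1.trans ?_
      gcongr
      linarith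
    · have h1 : ‖hess f x (y - x) - (gradient f y - gradient f x)‖ ≤ B * (2 * D) + 2 * G := by
        refine (norm_sub_le _ _).trans (add_le_add ?_ ?_)
        · exact (hhv x hx _).trans (mul_le_mul_of_nonneg_left (hdist x hx y hy) hB0)
        · exact (norm_sub_le _ _).trans (by linarith [hG x hx, hG y hy])
      have h6 := far (a := 2 * ‖hess f x (y - x) - (gradient f y - gradient f x)‖)
        (A := 2 * (B * (2 * D) + 2 * G)) 2 (by positivity) h (by linarith)
      have h7 : 0 ≤ (6 * C + A3 + 1) * ‖y - x‖ ^ 2 := by positivity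
      change _ ≤ A2 * _ at h6
      linarith
  · intro x hx y hy
    rcases lt_or_ge ‖y - x‖ δ with h | h
    · have h3 := (abs_le.1 (hnear x hx y h).2).2
      have h7 : 0 ≤ (A2 + A3 + 1) * ‖y - x‖ ^ 3 := by positivity
      linarith
    · have h3 := (abs_le.1 (hgr x hx (y - x))).1
      have h4 := mul_le_mul_of_nonneg_left (hdist x hx y hy) hG0
      have h5 := (abs_le.1 (hhq x hx (y - x))).1
      have h8 : B * ‖y - x‖ ^ 2 ≤ B * (2 * D) ^ 2 := by
        gcongr; exact hdist x hx y hy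
      have h6 := far (a := 6 * (f y - f x - inner ℝ (gradient f x) (y - x)
          - 1 / 2 * inner ℝ (y - x) (hess f x (y - x))))
        (A := 6 * (2 * F + G * (2 * D) + 1 / 2 * (B * (2 * D) ^ 2))) 3 (by positivity) h
        (by linarith [(abs_le.1 (hF x hx)).1, (abs_le.1 (hF y hy)).2])
      have h7 : 0 ≤ (6 * C + A2 + 1) * ‖y - x‖ ^ 3 := by positivity
      change _ ≤ A3 * _ at h6
      linarith
  · intro x hx
    have : 0 ≤ 2 * (C * δ) := by positivity
    linarith [hB x hx]

end Smoothness

/-! ### Conjugate gradients for a symmetric, possibly indefinite operator. -/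

section ConjugateGradients

variable {V : Type} [NormedAddCommGroup V] [InnerProductSpace ℝ V]

/-- The first `k` conjugate gradient steps do not break down. -/
def CGProper (Hb : V →ₗ[ℝ] V) (g : V) (k : ℕ) : Prop :=
  ∀ i < k, 0 < inner ℝ (cgIter Hb g i).p (Hb (cgIter Hb g i).p) ∧ (cgIter Hb g i).r ≠ 0

theorem CGProper.mono {Hb : V →ₗ[ℝ] V} {g : V} {k l : ℕ} (h : CGProper Hb g k) (hl : l ≤ k) :
    CGProper Hb g l := fun i hi => h i (hi.trans_le hl)

/-- The step length `α_j`. -/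
def cgAlpha (Hb : V →ₗ[ℝ] V) (g : V) (j : ℕ) : ℝ :=
  inner ℝ (cgIter Hb g j).r (cgIter Hb g j).r / inner ℝ (cgIter Hb g j).p (Hb (cgIter Hb g j).p)

/-- The coefficient `‖r_{j+1}‖² / ‖r_j‖²`. -/
def cgBeta (Hb : V →ₗ[ℝ] V) (g : V) (j : ℕ) : ℝ :=
  inner ℝ (cgIter Hb g (j + 1)).r (cgIter Hb g (j + 1)).r /
    inner ℝ (cgIter Hb g j).r (cgIter Hb g j).r

section

variable (Hb : V →ₗ[ℝ] V) (g : V)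

theorem cgIter_succ_y (j : ℕ) :
    (cgIter Hb g (j + 1)).y = (cgIter Hb g j).y + cgAlpha Hb g j • (cgIter Hb g j).p := rfl

theorem cgIter_succ_r (j : ℕ) :
    (cgIter Hb g (j + 1)).r = (cgIter Hb g j).r + cgAlpha Hb g j • Hb (cgIter Hb g j).p := rfl

theorem cgIter_succ_p (j : ℕ) :
    (cgIter Hb g (j + 1)).p = -(cgIter Hb g (j + 1)).r + cgBeta Hb g j • (cgIter Hb g j).p := rfl

theorem cgIter_r_eq (k : ℕ) : (cgIter Hb g k).r = g + Hb (cgIter Hb g k).y := by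
  induction k with
  | zero => simp [cgIter]
  | succ k ih => rw [cgIter_succ_r, cgIter_succ_y, ih, map_add, map_smul, add_assoc]

end

variable {Hb : V →ₗ[ℝ] V} {g : V}

theorem cgAlpha_pos {k i : ℕ} (h : CGProper Hb g k) (hi : i < k) : 0 < cgAlpha Hb g i :=
  div_pos (real_inner_self_pos.2 (h i hi).2) (h i hi).1

/-- The relations feed one another, so they are proved by one induction. Positive definiteness is
not needed, only positive curvature along the directions already used. -/
theorem cg_orthogonality (hs : Hb.IsSymmetric) (k : ℕ) (h : CGProper Hb g k) :
    (∀ i < k, inner ℝ (cgIter Hb g k).r (cgIter Hb g i).p = 0) ∧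
    (∀ i < k, inner ℝ (cgIter Hb g k).r (cgIter Hb g i).r = 0) ∧
    (∀ i < k, inner ℝ (cgIter Hb g k).p (Hb (cgIter Hb g i).p) = 0) ∧
    inner ℝ (cgIter Hb g k).r (cgIter Hb g k).p
      = -inner ℝ (cgIter Hb g k).r (cgIter Hb g k).r := by
  induction k with
  | zero => simp [cgIter]
  | succ k ih =>
    obtain ⟨h1, h2, h3, h4⟩ := ih (h.mono k.le_succ)
    obtain ⟨hp, hr⟩ := h k k.lt_succ_self
    have hα := cgAlpha_pos h k.lt_succ_self
    have hr' : inner ℝ (cgIter Hb g k).r (cgIter Hb g k).r ≠ (0 : ℝ) :=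
      (real_inner_self_pos.2 hr).ne'
    have hαp : cgAlpha Hb g k * inner ℝ (cgIter Hb g k).p (Hb (cgIter Hb g k).p)
        = inner ℝ (cgIter Hb g k).r (cgIter Hb g k).r := div_mul_cancel₀ _ hp.ne'
    have hβr : cgBeta Hb g k * inner ℝ (cgIter Hb g k).r (cgIter Hb g k).r
        = inner ℝ (cgIter Hb g (k + 1)).r (cgIter Hb g (k + 1)).r := div_mul_cancel₀ _ hr'
    have a1 : ∀ i < k + 1, inner ℝ (cgIter Hb g (k + 1)).r (cgIter Hb g i).p = 0 := by
      intro i hi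
      rw [cgIter_succ_r, inner_add_left, inner_smul_left]
      rcases Nat.lt_succ_iff_lt_or_eq.1 hi with hi | rfl
      · rw [h1 i hi, hs, h3 i hi]; simp
      · rw [h4, hs, conj_trivial]; linarith
    have a2 : ∀ i < k + 1, inner ℝ (cgIter Hb g (k + 1)).r (cgIter Hb g i).r = 0 := by
      intro i hi
      cases i with
      | zero =>
        have := a1 0 hi
        simpa [cgIter] using this
      | succ i =>
        have e : (cgIter Hb g (i + 1)).r
            = cgBeta Hb g i • (cgIter Hb g i).p - (cgIter Hb g (i + 1)).p := by
          rw [cgIter_succ_p]; abel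
        rw [e, inner_sub_right, inner_smul_right, a1 i (by omega), a1 (i + 1) hi]; simp
    have a3 : inner ℝ (cgIter Hb g (k + 1)).r (cgIter Hb g (k + 1)).p
        = -inner ℝ (cgIter Hb g (k + 1)).r (cgIter Hb g (k + 1)).r := by
      conv_lhs => rw [cgIter_succ_p, inner_add_right, inner_smul_right, inner_neg_right,
        a1 k k.lt_succ_self]
      simp
    refine ⟨a1, a2, fun i hi => ?_, a3⟩
    have hαi := cgAlpha_pos h hi
    have e : cgAlpha Hb g i * inner ℝ (cgIter Hb g (k + 1)).r (Hb (cgIter Hb g i).p)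
        = inner ℝ (cgIter Hb g (k + 1)).r (cgIter Hb g (i + 1)).r
          - inner ℝ (cgIter Hb g (k + 1)).r (cgIter Hb g i).r := by
      rw [cgIter_succ_r Hb g i, inner_add_right, inner_smul_right]; ring
    rw [a2 i hi] at e
    rw [cgIter_succ_p, inner_add_left, inner_smul_left, inner_neg_left]
    simp only [conj_trivial]
    rcases Nat.lt_succ_iff_lt_or_eq.1 hi with hi' | rfl
    · rw [a2 (i + 1) (by omega), sub_zero] at e
      rw [h3 i hi', (mul_eq_zero.1 e).resolve_left hαi.ne']; simp
    · refine mul_left_cancel₀ hαi.ne' ?_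
      -- Conjugacy to the last direction is what the choice of `cgBeta` achieves; for older
      -- directions both terms vanish.
      linear_combination -e + cgBeta Hb g i * hαp + hβr

/-- `y_i` is a combination of directions to which `r_k` is orthogonal. -/
theorem cg_inner_r_y (hs : Hb.IsSymmetric) {k : ℕ} (h : CGProper Hb g k) {i : ℕ} (hi : i ≤ k) :
    inner ℝ (cgIter Hb g k).r (cgIter Hb g i).y = 0 := by
  induction i with
  | zero => simp [cgIter]
  | succ i ih =>
    rw [cgIter_succ_y, inner_add_right, inner_smul_right, ih (by omega),
      (cg_orthogonality hs k h).1 i (by omega)]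
    simp

theorem cg_p_ne_zero (hs : Hb.IsSymmetric) {k : ℕ} (h : CGProper Hb g k)
    (hr : (cgIter Hb g k).r ≠ 0) : (cgIter Hb g k).p ≠ 0 := by
  intro hp
  have h4 := (cg_orthogonality hs k h).2.2.2
  rw [hp, inner_zero_right] at h4
  have := real_inner_self_pos.2 hr
  linarith

/-- Since `r = β p_k - p_{k+1}` with conjugate directions, the curvature of `r` is that of `p_{k+1}`
plus a nonnegative term. -/
theorem cg_curv_p_le (hs : Hb.IsSymmetric) {k : ℕ} (h : CGProper Hb g k) :
    inner ℝ (cgIter Hb g k).p (Hb (cgIter Hb g k).p)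
      ≤ inner ℝ (cgIter Hb g k).r (Hb (cgIter Hb g k).r) := by
  cases k with
  | zero => simp [cgIter]
  | succ k =>
    have h3 := (cg_orthogonality hs (k + 1) h).2.2.1 k k.lt_succ_self
    have hp := (h k k.lt_succ_self).1
    have e : (cgIter Hb g (k + 1)).r
        = cgBeta Hb g k • (cgIter Hb g k).p - (cgIter Hb g (k + 1)).p := by
      rw [cgIter_succ_p]; abel
    have h3' : inner ℝ (cgIter Hb g k).p (Hb (cgIter Hb g (k + 1)).p) = 0 := by
      rw [← hs, real_inner_comm, h3]
    rw [e]
    simp only [map_sub, map_smul, inner_sub_left, inner_sub_right, inner_smul_left,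
      inner_smul_right, h3, h3', conj_trivial]
    nlinarith [mul_nonneg (sq_nonneg (cgBeta Hb g k)) hp.le]

/-- The quadratic model `½⟨z, Hb z⟩ + ⟨g, z⟩` minimized by conjugate gradients. -/
def quadModel (Hb : V →ₗ[ℝ] V) (g z : V) : ℝ := 1 / 2 * inner ℝ z (Hb z) + inner ℝ g z

theorem quadModel_sub (hs : Hb.IsSymmetric) (w z : V) :
    quadModel Hb g w = quadModel Hb g z + inner ℝ (g + Hb z) (w - z)
      + 1 / 2 * inner ℝ (w - z) (Hb (w - z)) := by
  simp only [quadModel, map_sub, inner_sub_left, inner_sub_right, inner_add_left]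
  rw [hs z w, hs z z, real_inner_comm (Hb z) w, hs z w]
  ring

/-- Exact line search gains `α ‖r‖² / 2`, and `α ≥ 1 / L` because the curvature along `p` is at most
that along `r`. -/
theorem quadModel_cg_succ (hs : Hb.IsSymmetric) {k : ℕ} (h : CGProper Hb g (k + 1)) {L : ℝ}
    (hL : 0 < L)
    (hr : inner ℝ (cgIter Hb g k).r (Hb (cgIter Hb g k).r) ≤ L * ‖(cgIter Hb g k).r‖ ^ 2) :
    quadModel Hb g (cgIter Hb g (k + 1)).y
      ≤ quadModel Hb g (cgIter Hb g k).y - ‖(cgIter Hb g k).r‖ ^ 2 / (2 * L) := by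
  obtain ⟨hp, hr0⟩ := h k k.lt_succ_self
  have hk := h.mono k.le_succ
  have h4 := (cg_orthogonality hs k hk).2.2.2
  have hα := cgAlpha_pos h k.lt_succ_self
  have hαp : cgAlpha Hb g k * inner ℝ (cgIter Hb g k).p (Hb (cgIter Hb g k).p)
      = inner ℝ (cgIter Hb g k).r (cgIter Hb g k).r := div_mul_cancel₀ _ hp.ne'
  have hle := (cg_curv_p_le hs hk).trans hr
  have hrpos : 0 < ‖(cgIter Hb g k).r‖ ^ 2 := by positivity
  rw [real_inner_self_eq_norm_sq] at h4 hαp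
  rw [quadModel_sub hs _ (cgIter Hb g k).y, ← cgIter_r_eq, cgIter_succ_y, add_sub_cancel_left]
  simp only [map_smul, inner_smul_left, inner_smul_right, conj_trivial, h4, hαp]
  have h1 : 1 ≤ cgAlpha Hb g k * L := by
    by_contra! hlt
    have h5 := mul_le_mul_of_nonneg_left hle hα.le
    nlinarith
  have h2 : 1 / L ≤ cgAlpha Hb g k := by rwa [div_le_iff₀ hL]
  have h3 : ‖(cgIter Hb g k).r‖ ^ 2 / (2 * L) = 1 / L * ‖(cgIter Hb g k).r‖ ^ 2 / 2 := by
    field_simp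
  rw [h3]
  nlinarith [mul_le_mul_of_nonneg_right h2 hrpos.le]

/-- The centres of the estimate sequence used in the analysis of the decay of the residuals. -/
def estimateCentre (Hb : V →ₗ[ℝ] V) (g : V) (a ε : ℝ) : ℕ → V
  | 0 => 0
  | i + 1 => (1 - a) • estimateCentre Hb g a ε i + a • (cgIter Hb g i).y
      - (a / ε) • (cgIter Hb g i).r

theorem inner_r_estimateCentre (hs : Hb.IsSymmetric) {k : ℕ} (h : CGProper Hb g k) (a ε : ℝ)
    {i : ℕ} (hi : i ≤ k) : inner ℝ (cgIter Hb g k).r (estimateCentre Hb g a ε i) = 0 := by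
  induction i with
  | zero => simp [estimateCentre]
  | succ i ih =>
    rw [estimateCentre, inner_sub_right, inner_add_right, inner_smul_right, inner_smul_right,
      inner_smul_right, ih (by omega), cg_inner_r_y hs h (by omega),
      (cg_orthogonality hs k h).2.1 i (by omega)]
    simp

/-- Used with `p = w - v_i` and `q = w - y_i`: as `r` is orthogonal to both `v_i` and `y_i`, the two
cross terms merge into `a ⟨r, q⟩`. -/
theorem estimate_identity (p q r : V) (a ε : ℝ) (hε : ε ≠ 0) (hr : inner ℝ r p = inner ℝ r q) :
    ε / 2 * ‖(1 - a) • p + a • q + (a / ε) • r‖ ^ 2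
      = (1 - a) * (ε / 2 * ‖p‖ ^ 2) + a * (ε / 2 * ‖q‖ ^ 2) - a * (1 - a) * (ε / 2) * ‖p - q‖ ^ 2
        + a ^ 2 / (2 * ε) * ‖r‖ ^ 2 + a * inner ℝ r q := by
  simp only [← real_inner_self_eq_norm_sq, inner_add_left, inner_add_right, inner_sub_left,
    inner_sub_right, inner_smul_left, inner_smul_right, conj_trivial, real_inner_comm r p,
    real_inner_comm r q, real_inner_comm p q, hr]
  field_simp
  ring

/-- If the quadratic is `ε`-strongly convex between the iterate `y_{j+1}` and all its predecessors,
then the residuals decay at a linear rate. -/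
theorem cg_residual_decay (hs : Hb.IsSymmetric) {j : ℕ} (hj : 1 ≤ j) (h : CGProper Hb g (j + 1))
    {ε κ : ℝ} (hε : 0 < ε) (hκ : 1 ≤ κ)
    (hL : ∀ i ≤ j, inner ℝ (cgIter Hb g i).r (Hb (cgIter Hb g i).r)
      ≤ ε * κ * ‖(cgIter Hb g i).r‖ ^ 2)
    (hconv : ∀ i < j, ε * ‖(cgIter Hb g (j + 1)).y - (cgIter Hb g i).y‖ ^ 2
      ≤ inner ℝ ((cgIter Hb g (j + 1)).y - (cgIter Hb g i).y)
          (Hb ((cgIter Hb g (j + 1)).y - (cgIter Hb g i).y))) :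
    ‖(cgIter Hb g j).r‖ ^ 2 ≤ 4 * κ * (√κ / (√κ + 1)) ^ j * ‖g‖ ^ 2 := by
  have hsκ : 1 ≤ √κ := Real.one_le_sqrt.2 hκ
  have hκsq : √κ ^ 2 = κ := Real.sq_sqrt (by linarith)
  have hκ0 : 0 < κ := by linarith
  -- With this `a` the factor `1 - a` is the rate `τ` of the method, and `a ^ 2 * κ ≤ 1` lets the
  -- decrease of one CG step absorb the term `a² ‖r‖² / (2ε)`.
  set a : ℝ := 1 / (√κ + 1) with ha
  have ha0 : 0 < a := by positivity
  have ha1 : a ≤ 1 := by rw [ha, div_le_one (by positivity)]; linarith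
  have haτ : 1 - a = √κ / (√κ + 1) := by rw [ha]; field_simp; ring
  have ha2 : a ^ 2 * κ ≤ 1 := by
    rw [ha, div_pow, one_pow, div_mul_eq_mul_div, one_mul, div_le_one (by positivity)]
    nlinarith
  set w := (cgIter Hb g (j + 1)).y with hw
  set v := estimateCentre Hb g a ε with hv
  set Φ := quadModel Hb g with hΦ
  have hsc : ∀ i < j, Φ (cgIter Hb g i).y + inner ℝ (cgIter Hb g i).r (w - (cgIter Hb g i).y)
      + ε / 2 * ‖w - (cgIter Hb g i).y‖ ^ 2 ≤ Φ w := by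
    intro i hi
    have := quadModel_sub (g := g) hs w (cgIter Hb g i).y
    rw [← cgIter_r_eq] at this
    have := hconv i hi
    linarith
  have hdec : ∀ i ≤ j, Φ (cgIter Hb g (i + 1)).y
      ≤ Φ (cgIter Hb g i).y - ‖(cgIter Hb g i).r‖ ^ 2 / (2 * (ε * κ)) := fun i hi =>
    quadModel_cg_succ hs (h.mono (by omega)) (by positivity) (hL i hi)
  -- A Lyapunov function of Nesterov type, contracting by `1 - a`. The target is `w = y_{j+1}`
  -- rather than a minimizer, so strong convexity is needed only between `w` and earlier iterates.
  have hest : ∀ i ≤ j, Φ (cgIter Hb g i).y - Φ w + ε / 2 * ‖w - v i‖ ^ 2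
      ≤ (1 - a) ^ i * (ε / 2 * ‖w‖ ^ 2 - Φ w) := by
    intro i
    induction i with
    | zero =>
      intro _
      have h1 : v 0 = 0 := rfl
      have h2 : Φ (cgIter Hb g 0).y = 0 := by simp [hΦ, quadModel, cgIter]
      rw [h1, h2, sub_zero]
      linarith
    | succ i ih =>
      intro hi
      have ih := ih (by omega)
      have e1 : w - v (i + 1) = (1 - a) • (w - v i) + a • (w - (cgIter Hb g i).y)
          + (a / ε) • (cgIter Hb g i).r := by
        rw [hv, estimateCentre]
        module
      have hri := h.mono (show i ≤ j + 1 by omega)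
      have e2 := estimate_identity (w - v i) (w - (cgIter Hb g i).y) (cgIter Hb g i).r a ε hε.ne'
        (by rw [inner_sub_right, inner_sub_right, inner_r_estimateCentre hs hri a ε le_rfl,
              cg_inner_r_y hs hri le_rfl])
      rw [e1, e2]
      have h1 := hdec i (by omega)
      have h2 := mul_le_mul_of_nonneg_left (hsc i (by omega)) ha0.le
      have h3 : 0 ≤ a * (1 - a) * (ε / 2) * ‖w - v i - (w - (cgIter Hb g i).y)‖ ^ 2 := by
        have : 0 ≤ 1 - a := by linarith
        positivity
      have h4 : a ^ 2 / (2 * ε) * ‖(cgIter Hb g i).r‖ ^ 2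
          ≤ ‖(cgIter Hb g i).r‖ ^ 2 / (2 * (ε * κ)) := by
        rw [div_mul_eq_mul_div, div_le_div_iff₀ (by positivity) (by positivity)]
        have : 0 ≤ 2 * ε * ‖(cgIter Hb g i).r‖ ^ 2 := by positivity
        nlinarith
      have h5 := mul_le_mul_of_nonneg_left ih (show 0 ≤ 1 - a by linarith)
      rw [pow_succ (1 - a) i]
      linarith
  have h1 := hest j le_rfl
  have h2 := hdec j le_rfl
  have h3 := hsc 0 (by omega)
  have h0y : (cgIter Hb g 0).y = 0 := rfl
  have h0r : (cgIter Hb g 0).r = g := rfl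
  have hΦ0 : Φ 0 = 0 := by simp [hΦ, quadModel]
  rw [h0y, h0r, sub_zero, hΦ0, zero_add] at h3
  have hmono : ∀ i ≤ j + 1, Φ (cgIter Hb g i).y ≤ 0 := by
    intro i
    induction i with
    | zero => intro _; rw [h0y, hΦ0]
    | succ i ih =>
      intro hi
      have : 0 ≤ ‖(cgIter Hb g i).r‖ ^ 2 / (2 * (ε * κ)) := by positivity
      linarith [ih (by omega), hdec i (by omega)]
  have hw0 : Φ w ≤ 0 := hmono (j + 1) le_rfl
  have hgw := (abs_le.1 (abs_real_inner_le_norm g w)).1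
  have hwn : ε * ‖w‖ ≤ 2 * ‖g‖ := by
    rcases (norm_nonneg w).eq_or_lt with h | h
    · rw [← h]; simp
    · refine le_of_mul_le_mul_right ?_ h
      nlinarith
  -- Strong convexity at `y_0 = 0` bounds the left side by `-⟨g, w⟩`, and together with `Φ w ≤ 0` it
  -- gives `ε ‖w‖ ≤ 2 ‖g‖`.
  have h4 : ε / 2 * ‖w‖ ^ 2 - Φ w ≤ 2 * ‖g‖ ^ 2 / ε := by
    rw [le_div_iff₀ hε]
    have : (ε / 2 * ‖w‖ ^ 2 - Φ w) * ε ≤ ‖g‖ * (ε * ‖w‖) := by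
      rw [show ‖g‖ * (ε * ‖w‖) = (‖g‖ * ‖w‖) * ε by ring]
      exact mul_le_mul_of_nonneg_right (by linarith) hε.le
    nlinarith [norm_nonneg g]
  have hpow : 0 ≤ (1 - a) ^ j := pow_nonneg (by linarith) _
  have h5 : ‖(cgIter Hb g j).r‖ ^ 2 / (2 * (ε * κ)) ≤ (1 - a) ^ j * (2 * ‖g‖ ^ 2 / ε) := by
    have := mul_le_mul_of_nonneg_left h4 hpow
    have : 0 ≤ ε / 2 * ‖w - v j‖ ^ 2 := by positivity
    linarith
  rw [div_le_iff₀ (by positivity)] at h5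
  rw [← haτ]
  calc _ ≤ _ := h5
    _ = _ := by field_simp; ring

end ConjugateGradients

/-! ### Capped CG: termination and quality of the output. -/

section CappedCG

variable {V : Type} [NormedAddCommGroup V] [InnerProductSpace ℝ V]

theorem le_raiseM (H : V →ₗ[ℝ] V) (M : ℝ) (v : V) : M ≤ raiseM H M v := by
  unfold raiseM
  split_ifs with h
  · have hv : v ≠ 0 := by rintro rfl; simp at h
    exact ((lt_div_iff₀ (norm_pos_iff.2 hv)).2 h).le
  · exact le_rfl

theorem norm_le_raiseM_mul (H : V →ₗ[ℝ] V) (M : ℝ) (v : V) : ‖H v‖ ≤ raiseM H M v * ‖v‖ := by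
  unfold raiseM
  split_ifs with h
  · have hv : v ≠ 0 := by rintro rfl; simp at h
    rw [div_mul_cancel₀ _ (norm_ne_zero_iff.2 hv)]
  · exact not_lt.1 h

theorem ccgM_mono (H Hb : V →ₗ[ℝ] V) (g : V) (M₀ : ℝ) : Monotone (ccgM H Hb g M₀) :=
  monotone_nat_of_le_succ fun _ =>
    (le_raiseM _ _ _).trans ((le_raiseM _ _ _).trans (le_raiseM _ _ _))

namespace CCGInput

variable {I : CCGInput V}

/-- The current estimate of the norm of `H` in iteration `j`. -/
def M (I : CCGInput V) (j : ℕ) : ℝ := ccgM I.H I.Hb I.g I.M₀ j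

theorem norm_H_r_le {i j : ℕ} (hij : i ≤ j) : ‖I.H (I.r i)‖ ≤ I.M j * ‖I.r i‖ := by
  have h : I.M i ≤ I.M j := ccgM_mono I.H I.Hb I.g I.M₀ hij
  refine le_trans ?_ (mul_le_mul_of_nonneg_right h (norm_nonneg _))
  cases i with
  | zero =>
    have := norm_le_raiseM_mul I.H I.M₀ (cgIter I.Hb I.g 0).p
    simpa [M, ccgM, r, cgIter] using this
  | succ i => exact norm_le_raiseM_mul I.H _ _

theorem norm_H_y_le (j : ℕ) : ‖I.H (I.y j)‖ ≤ I.M j * ‖I.y j‖ := by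
  cases j with
  | zero => simp [y, cgIter]
  | succ j =>
    exact (norm_le_raiseM_mul I.H _ _).trans
      (mul_le_mul_of_nonneg_right (le_raiseM _ _ _) (norm_nonneg _))

theorem norm_H_p_zero_le : ‖I.H (I.p 0)‖ ≤ I.M 0 * ‖I.p 0‖ := norm_le_raiseM_mul I.H _ _

theorem Hb_apply (v : V) : I.Hb v = I.H v + I.c • v := rfl

theorem Hb_isSymmetric (hs : I.H.IsSymmetric) : I.Hb.IsSymmetric := fun v w => by
  rw [Hb_apply, Hb_apply, inner_add_left, inner_add_right, hs, inner_smul_left, inner_smul_right]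
  simp

theorem norm_Hb_le (hc : 0 ≤ I.c) {m : ℝ} {v : V} (h : ‖I.H v‖ ≤ m * ‖v‖) :
    ‖I.Hb v‖ ≤ (m + I.c) * ‖v‖ := by
  rw [Hb_apply, add_mul]
  refine (norm_add_le _ _).trans (add_le_add h ?_)
  rw [norm_smul, Real.norm_of_nonneg hc]

theorem inner_Hb_le (hc : 0 ≤ I.c) {m : ℝ} {v : V} (h : ‖I.H v‖ ≤ m * ‖v‖) :
    inner ℝ v (I.Hb v) ≤ (m + I.c) * ‖v‖ ^ 2 := by
  have := mul_le_mul_of_nonneg_left (norm_Hb_le hc h) (norm_nonneg v)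
  linarith [real_inner_le_norm v (I.Hb v)]

theorem mul_kappa (hε : 0 < I.ε) (j : ℕ) : I.ε * I.kappa j = I.M j + I.c :=
  mul_div_cancel₀ _ hε.ne'

/-- Along `p_0` the curvature of `Hb` is at least `ε` and at most `M + c`; afterwards `M` can only
grow. -/
theorem one_le_kappa (hg : I.g ≠ 0) (hε : 0 < I.ε) (hc : 0 ≤ I.c) (h : ¬ I.LowCurv (I.p 0))
    (j : ℕ) : 1 ≤ I.kappa j := by
  have h1 := (not_lt.1 h).trans (inner_Hb_le hc norm_H_p_zero_le)
  have h2 : 0 < ‖I.p 0‖ ^ 2 := by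
    have : I.p 0 ≠ 0 := neg_ne_zero.2 hg
    positivity
  have h3 : I.ε ≤ I.M 0 + I.c := le_of_mul_le_mul_right h1 h2
  have h4 : I.M 0 ≤ I.M j := ccgM_mono I.H I.Hb I.g I.M₀ (Nat.zero_le j)
  have h5 := I.mul_kappa hε j
  nlinarith

theorem not_lowCurv_p_zero {j : ℕ} (hj : 1 ≤ j) (h : ∀ l < j, I.Continues l) :
    ¬ I.LowCurv (I.p 0) := by
  have := h 0 hj
  simpa [Continues] using this

theorem r_ne_zero (hg : I.g ≠ 0) (hε : 0 < I.ε) (hc : 0 ≤ I.c) (hζ : 0 < I.ζ) {j : ℕ}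
    (h0 : ¬ I.LowCurv (I.p 0)) (h : j = 0 ∨ ¬ I.SmallRes j) : I.r j ≠ 0 := by
  rcases h with rfl | h
  · exact hg
  · intro h1
    refine h ?_
    have := one_le_kappa hg hε hc h0 j
    rw [SmallRes, h1, norm_zero, zetaHat]
    positivity

/-- The tests of the loop exclude breakdown: a vanishing residual would count as small, and a
surviving direction has curvature at least `ε`. -/
theorem cgProper (hs : I.H.IsSymmetric) (hg : I.g ≠ 0) (hε : 0 < I.ε) (hc : 0 ≤ I.c)
    (hζ : 0 < I.ζ) {j : ℕ} (h : ∀ l < j, I.Continues l) : CGProper I.Hb I.g j := by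
  induction j with
  | zero => exact fun i hi => absurd hi (Nat.not_lt_zero i)
  | succ j ih =>
    have ihj := ih fun l hl => h l (by omega)
    intro i hi
    rcases Nat.lt_succ_iff_lt_or_eq.1 hi with hi' | rfl
    · exact ihj i hi'
    · have h0 := not_lowCurv_p_zero (by omega) h
      have hci := h i hi
      have hr : I.r i ≠ 0 := by
        refine r_ne_zero hg hε hc hζ h0 ?_
        by_cases h1 : i = 0
        · exact Or.inl h1
        · rw [Continues, if_neg h1] at hci
          exact Or.inr hci.2.1
      have hp : ¬ I.LowCurv (I.p i) := by
        by_cases h1 : i = 0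
        · rw [h1]; exact h0
        · rw [Continues, if_neg h1] at hci
          exact hci.2.2.1
      refine ⟨?_, hr⟩
      have hp0 : I.p i ≠ 0 := cg_p_ne_zero (Hb_isSymmetric hs) ihj hr
      have h2 := not_lt.1 hp
      have : 0 < I.ε * ‖I.p i‖ ^ 2 := by positivity
      exact this.trans_le h2

/-- If the residuals decay slowly, then there is a direction of low curvature among the differences
of the iterates. -/
theorem exists_lowCurv_of_slowDecay (hs : I.H.IsSymmetric) (hg : I.g ≠ 0) (hε : 0 < I.ε)
    (hc : 0 ≤ I.c) (hζ : 0 < I.ζ) {j : ℕ} (hj : j ≠ 0) (h : ∀ l < j, I.Continues l)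
    (h1 : ¬ I.SmallRes j) (h2 : ¬ I.LowCurv (I.p j)) (h3 : I.SlowDecay j) :
    ∃ i < j, I.LowCurv (I.y (j + 1) - I.y i) := by
  by_contra! hcon
  have h0 := not_lowCurv_p_zero (by omega) h
  have hsb := Hb_isSymmetric hs
  have hprop := cgProper hs hg hε hc hζ h
  have hκ := one_le_kappa hg hε hc h0 j
  have hr := r_ne_zero hg hε hc hζ h0 (Or.inr h1)
  have hprop' : CGProper I.Hb I.g (j + 1) := by
    intro i hi
    rcases Nat.lt_succ_iff_lt_or_eq.1 hi with hi' | rfl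
    · exact hprop i hi'
    · refine ⟨?_, hr⟩
      have hp0 : I.p i ≠ 0 := cg_p_ne_zero hsb hprop hr
      have : 0 < I.ε * ‖I.p i‖ ^ 2 := by positivity
      exact this.trans_le (not_lt.1 h2)
  have hdecay := cg_residual_decay hsb (Nat.one_le_iff_ne_zero.2 hj) hprop' hε hκ
    (fun i hi => by
      rw [mul_kappa hε]
      exact inner_Hb_le hc (norm_H_r_le hi))
    (fun i hi => not_lt.1 (hcon i hi))
  have hτ0 : 0 < I.tau j := by unfold tau; positivity
  have hτ1 : I.tau j < 1 := by
    unfold tau; rw [div_lt_one (by positivity)]; linarith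
  -- The threshold of the method exceeds the constant `4κ` of `cg_residual_decay`, so slow decay
  -- contradicts that bound.
  have hT : 4 * I.kappa j ≤ I.T j := by
    have hs1 : √(I.tau j) < 1 := by rw [Real.sqrt_lt' one_pos]; simpa using hτ1
    have hs0 := Real.sqrt_nonneg (I.tau j)
    unfold T
    rw [le_div_iff₀ (by have : 0 < 1 - √(I.tau j) := by linarith
                        positivity)]
    have e1 : (1 - √(I.tau j)) ^ 2 ≤ 1 := by nlinarith
    have e2 : I.kappa j ^ 1 ≤ I.kappa j ^ 4 := pow_le_pow_right₀ hκ (by norm_num)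
    have e3 : 4 * I.kappa j * (1 - √(I.tau j)) ^ 2 ≤ 4 * I.kappa j * 1 :=
      mul_le_mul_of_nonneg_left e1 (by linarith)
    linarith
  have hsq : (√(I.T j) * I.tau j ^ ((j : ℝ) / 2) * ‖I.r 0‖) ^ 2
      = I.T j * I.tau j ^ j * ‖I.g‖ ^ 2 := by
    have : (I.tau j ^ ((j : ℝ) / 2)) ^ 2 = I.tau j ^ j := by
      rw [← Real.rpow_natCast, ← Real.rpow_mul hτ0.le]
      norm_num
    rw [mul_pow, mul_pow, this, Real.sq_sqrt (by linarith)]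
    rfl
  have hlt : (√(I.T j) * I.tau j ^ ((j : ℝ) / 2) * ‖I.r 0‖) ^ 2 < ‖I.r j‖ ^ 2 :=
    pow_lt_pow_left₀ h3 (by positivity) two_ne_zero
  rw [hsq] at hlt
  have : 4 * I.kappa j * I.tau j ^ j * ‖I.g‖ ^ 2 ≤ I.T j * I.tau j ^ j * ‖I.g‖ ^ 2 := by
    gcongr
  exact absurd (hdecay.trans this) (not_le.2 hlt)

/-- An endless loop would yield infinitely many nonzero, pairwise orthogonal residuals. -/
theorem exists_not_continues [FiniteDimensional ℝ V] (hs : I.H.IsSymmetric) (hg : I.g ≠ 0)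
    (hε : 0 < I.ε) (hc : 0 ≤ I.c) (hζ : 0 < I.ζ) : ∃ j, ¬ I.Continues j := by
  by_contra! h
  have hprop : ∀ k, CGProper I.Hb I.g k := fun k => cgProper hs hg hε hc hζ fun l _ => h l
  have hli : LinearIndependent ℝ I.r := by
    refine linearIndependent_of_ne_zero_of_inner_eq_zero
      (fun i => (hprop (i + 1) i i.lt_succ_self).2) fun i j hij => ?_
    rcases lt_or_gt_of_ne hij with hlt | hlt
    · rw [real_inner_comm]
      exact (cg_orthogonality (Hb_isSymmetric hs) j (hprop j)).2.1 i hlt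
    · exact (cg_orthogonality (Hb_isSymmetric hs) i (hprop i)).2.1 j hlt
  have := hli.finite
  exact not_finite ℕ

theorem exists_returns [FiniteDimensional ℝ V] (hs : I.H.IsSymmetric) (hg : I.g ≠ 0)
    (hε : 0 < I.ε) (hc : 0 ≤ I.c) (hζ : 0 < I.ζ) : ∃ d ty, I.Returns d ty := by
  classical
  have hex := exists_not_continues hs hg hε hc hζ
  set j := Nat.find hex with hj
  have hlt : ∀ l < j, I.Continues l := fun l hl => not_not.1 (Nat.find_min hex hl)
  have hnc : ¬ I.Continues j := Nat.find_spec hex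
  suffices ∃ d ty, I.Exits j d ty by
    obtain ⟨d, ty, h⟩ := this
    exact ⟨d, ty, j, hlt, h⟩
  unfold Exits
  unfold Continues at hnc
  by_cases h0 : j = 0
  · simp only [if_pos h0, not_not] at hnc ⊢
    exact ⟨_, _, hnc, rfl, rfl⟩
  simp only [if_neg h0] at hnc ⊢
  by_cases h1 : I.LowCurv (I.y j)
  · simp only [if_pos h1]; exact ⟨_, _, rfl, rfl⟩
  simp only [if_neg h1]
  by_cases h2 : I.SmallRes j
  · simp only [if_pos h2]; exact ⟨_, _, rfl, rfl⟩
  simp only [if_neg h2]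
  by_cases h3 : I.LowCurv (I.p j)
  · simp only [if_pos h3]; exact ⟨_, _, rfl, rfl⟩
  simp only [if_neg h3]
  have h4 : I.SlowDecay j := by
    by_contra h4
    exact hnc ⟨h1, h2, h3, h4⟩
  simp only [if_pos h4]
  obtain ⟨i, hi, hl⟩ := exists_lowCurv_of_slowDecay hs hg hε hc hζ h0 hlt h2 h3 h4
  exact ⟨_, _, i, hi, hl, rfl, rfl⟩

theorem Returns.lowCurv {d : V} (h : I.Returns d DType.NC) : I.LowCurv d := by
  obtain ⟨j, -, h⟩ := h
  unfold Exits at h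
  split_ifs at h with h0 h1 h2 h3 h4
  · exact h.2.1 ▸ h.1
  · exact h.1 ▸ h1
  · cases h.2
  · exact h.1 ▸ h3
  · obtain ⟨i, -, h5, h6, -⟩ := h
    exact h6 ▸ h5

/-- The residual is tested against `‖g‖` but needed against `‖y‖`; the conversion uses `‖g‖ ≤ ‖r‖ +
εκ ‖y‖`. The formula for `⟨g, d⟩` is the orthogonality of `r` and `y`. -/
theorem Returns.approx_solution (hs : I.H.IsSymmetric) (hg : I.g ≠ 0) (hε : 0 < I.ε)
    (hc : 0 ≤ I.c) (hζ : 0 < I.ζ) (hζ1 : I.ζ < 1) {d : V} (h : I.Returns d DType.SOL) :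
    d ≠ 0 ∧ I.ε * ‖d‖ ^ 2 ≤ inner ℝ d (I.Hb d) ∧ inner ℝ I.g d = -inner ℝ d (I.Hb d) ∧
      ‖I.g + I.Hb d‖ ≤ I.ζ * I.ε / 2 * ‖d‖ := by
  obtain ⟨j, hlt, h⟩ := h
  unfold Exits at h
  split_ifs at h with h0 h1 h2 h3 h4
  · cases h.2.2
  · cases h.2
  swap
  · cases h.2
  swap
  · obtain ⟨i, -, -, -, h6⟩ := h
    cases h6
  obtain ⟨rfl, -⟩ := h
  have hprop := cgProper hs hg hε hc hζ hlt
  have hκ := one_le_kappa hg hε hc (not_lowCurv_p_zero (by omega) hlt) j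
  have hr : I.r j = I.g + I.Hb (I.y j) := cgIter_r_eq I.Hb I.g j
  have hry : inner ℝ (I.r j) (I.y j) = 0 := cg_inner_r_y (Hb_isSymmetric hs) hprop le_rfl
  have hres : ‖I.r j‖ ≤ I.ζ / (3 * I.kappa j) * ‖I.g‖ := h2
  have hres' : ‖I.r j‖ ≤ I.ζ * I.ε / 2 * ‖I.y j‖ := by
    have h5 := norm_Hb_le hc (norm_H_y_le (I := I) j)
    rw [← mul_kappa hε] at h5
    have h6 : ‖I.g‖ ≤ ‖I.r j‖ + ‖I.Hb (I.y j)‖ := by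
      rw [show I.g = I.r j - I.Hb (I.y j) by rw [hr]; abel]
      exact norm_sub_le _ _
    rw [div_mul_eq_mul_div, le_div_iff₀ (by positivity)] at hres
    have h7 : I.ζ * ‖I.g‖ ≤ I.ζ * (‖I.r j‖ + I.ε * I.kappa j * ‖I.y j‖) :=
      mul_le_mul_of_nonneg_left (by linarith) hζ.le
    -- Of the `3κ ‖r‖` on the left, one `κ ‖r‖` absorbs `ζ ‖r‖`, since `ζ < 1 ≤ κ`; the other two
    -- give the factor 1/2.
    have h8 : I.ζ * ‖I.r j‖ ≤ I.kappa j * ‖I.r j‖ :=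
      mul_le_mul_of_nonneg_right (by linarith) (norm_nonneg _)
    have h9 : I.kappa j * ‖I.r j‖ ≤ I.kappa j * (I.ζ * I.ε / 2 * ‖I.y j‖) := by linarith
    exact le_of_mul_le_mul_left h9 (by linarith)
  refine ⟨?_, not_lt.1 h1, ?_, hr ▸ hres'⟩
  · intro hy
    rw [hy, norm_zero, mul_zero] at hres'
    have : I.r j = 0 := norm_le_zero_iff.1 hres'
    rw [hr, hy, map_zero, add_zero] at this
    exact hg this
  · rw [hr, inner_add_left, real_inner_comm (I.y j) (I.Hb (I.y j))] at hry
    linarith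

end CCGInput

end CappedCG

/-! ### The proximal gradient step. -/

section ProxStep

/-- A continuous function that stays below the level `c` near `0`, and that is below `c` strictly
wherever it is at most `c`, stays below `c`. -/
theorem le_of_forall_lt_of_le {F : ℝ → ℝ} {T c : ℝ} (hF : Continuous F)
    (hd : ∀ s, 0 < s → s ≤ T → F s ≤ c → F s < c)
    (hsmall : ∃ s₀ > 0, ∀ s, 0 < s → s ≤ s₀ → F s ≤ c) {s : ℝ} (hs : 0 < s) (hsT : s ≤ T) :
    F s ≤ c := by
  by_contra! hlt
  obtain ⟨s₀, hs₀, h⟩ := hsmall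
  have hm : 0 < min s₀ s := lt_min hs₀ hs
  obtain ⟨u, ⟨hu1, hu2⟩, hu⟩ := intermediate_value_Icc (min_le_right s₀ s) hF.continuousOn
    ⟨h _ hm (min_le_left _ _), hlt.le⟩
  exact (hd u (hm.trans_le hu1) (hu2.trans hsT) hu.le).ne hu

variable {n : ℕ} {f : E n → ℝ} {lam : ℝ} {x₀ x : E n}

theorem l1_sub_le (x y : E n) : l1 x - l1 y ≤ n * ‖x - y‖ := by
  unfold l1
  rw [← Finset.sum_sub_distrib]
  calc ∑ i, (|x i| - |y i|) ≤ ∑ _i : Fin n, ‖x - y‖ := Finset.sum_le_sum fun i _ =>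
        (abs_sub_abs_le_abs_sub _ _).trans (PiLp.norm_apply_le (x - y) i)
    _ = _ := by simp

/-- The path of proximal gradient points, parametrized by the step size. -/
def proxPath (f : E n → ℝ) (lam : ℝ) (x : E n) (s : ℝ) : E n :=
  WithLp.toLp 2 fun i => x i - s * gradient f x i
    - max (-(lam * s)) (min (x i - s * gradient f x i) (lam * s))

theorem continuous_proxPath : Continuous (proxPath f lam x) := by
  unfold proxPath; fun_prop

/-- Soft thresholding subtracts the projection onto an interval; in this form continuity in the step
size is evident. -/
theorem proxPoint_eq_proxPath (hlam : 0 < lam) {t : ℝ} (ht : 0 < t) :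
    proxPoint f lam t x = proxPath f lam x (1 / t) := by
  have hμ : 0 < lam * (1 / t) := by positivity
  ext i
  simp only [proxPoint, proxL1, proxPath, PiLp.sub_apply, PiLp.smul_apply, smul_eq_mul,
    div_eq_mul_one_div lam t]
  split_ifs with h1 h2
  · rw [min_eq_right h1.le, max_eq_right (by linarith)]
  · rw [min_eq_left (by linarith), max_eq_left h2.le]; ring
  · rw [min_eq_left (not_lt.1 h1), max_eq_right (not_lt.1 h2), sub_self]

/-- Strong convexity of the proximal subproblem, with `x` as competitor, gives the full `t ‖p - x‖²`
instead of half of it. -/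
theorem proxPoint_ineq (hlam : 0 < lam) {t : ℝ} (ht : 0 < t) :
    lam * l1 (proxPoint f lam t x) + inner ℝ (gradient f x) (proxPoint f lam t x - x)
      + t * ‖proxPoint f lam t x - x‖ ^ 2 ≤ lam * l1 x := by
  have h := proxL1_ineq (div_nonneg hlam.le ht.le) (x - (1 / t) • gradient f x) x
  change lam / t * l1 (proxPoint f lam t x)
    + 1 / 2 * ‖proxPoint f lam t x - (x - (1 / t) • gradient f x)‖ ^ 2
    + 1 / 2 * ‖x - proxPoint f lam t x‖ ^ 2 ≤ _ at h
  set p := proxPoint f lam t x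
  rw [show p - (x - (1 / t) • gradient f x) = (p - x) + (1 / t) • gradient f x by abel,
    norm_add_sq_real, inner_smul_right, real_inner_comm, norm_sub_rev x p, sub_sub_cancel] at h
  have h2 := mul_le_mul_of_nonneg_left h ht.le
  have e1 : t * (lam / t * l1 p + 1 / 2 * (‖p - x‖ ^ 2 + 2 * (1 / t * inner ℝ (gradient f x) (p - x))
      + ‖(1 / t) • gradient f x‖ ^ 2) + 1 / 2 * ‖p - x‖ ^ 2)
      = lam * l1 p + inner ℝ (gradient f x) (p - x) + t * ‖p - x‖ ^ 2
        + t * (1 / 2 * ‖(1 / t) • gradient f x‖ ^ 2) := by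
    field_simp; ring
  have e2 : t * (lam / t * l1 x + 1 / 2 * ‖(1 / t) • gradient f x‖ ^ 2)
      = lam * l1 x + t * (1 / 2 * ‖(1 / t) • gradient f x‖ ^ 2) := by
    field_simp
  linarith

theorem norm_proxPoint_sub_le (hlam : 0 < lam) {t : ℝ} (ht : 0 < t) :
    t * ‖proxPoint f lam t x - x‖ ≤ lam * n + ‖gradient f x‖ := by
  have h := proxPoint_ineq (f := f) (x := x) hlam ht
  set p := proxPoint f lam t x
  rcases (norm_nonneg (p - x)).eq_or_lt with h0 | h0
  · rw [← h0, mul_zero]; positivity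
  · refine le_of_mul_le_mul_right ?_ h0
    have h1 := mul_le_mul_of_nonneg_left (l1_sub_le x p) hlam.le
    have h2 := (abs_le.1 (abs_real_inner_le_norm (gradient f x) (p - x))).1
    rw [norm_sub_rev x p] at h1
    linarith

theorem norm_gradMap_sq {t : ℝ} :
    ‖gradMap f lam t x‖ ^ 2 = t ^ 2 * ‖proxPoint f lam t x - x‖ ^ 2 := by
  rw [gradMap, norm_smul, mul_pow, norm_sub_rev, Real.norm_eq_abs, sq_abs]

/-- Some small coordinate has `|∇_i f| > lam + εg ^ (3/4)`. There the gradient mapping is `∇_i f ±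
lam`, or `t * x_i` when the coordinate is set to zero, and then `t * x_i` is within `lam` of `∇_i
f`. -/
theorem le_norm_gradMap (hlam : 0 < lam) {εg : ℝ} (hb : ProxBranch f lam εg x) {t : ℝ}
    (ht : 0 < t) : εg ^ (3 / 4 : ℝ) ≤ ‖gradMap f lam t x‖ := by
  obtain ⟨-, hb⟩ := hb
  have : ∃ i ∈ smallIdx εg x, gEps f lam εg x i ≠ 0 := by
    by_contra! h
    refine hb (norm_eq_zero.2 ?_)
    ext i
    exact h i i.2
  obtain ⟨i, hi, hne⟩ := this
  have hi' : |x i| ≤ εg ^ (1 / 2 : ℝ) := (Finset.mem_filter.1 hi).2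
  rw [abs_le] at hi'
  refine le_trans ?_ (PiLp.norm_apply_le (gradMap f lam t x) i)
  have hG : gradMap f lam t x i = t * (x i - proxPoint f lam t x i) := rfl
  have hp : proxPoint f lam t x i = if lam / t < x i - 1 / t * gradient f x i then
      x i - 1 / t * gradient f x i - lam / t else if x i - 1 / t * gradient f x i < -(lam / t) then
      x i - 1 / t * gradient f x i + lam / t else 0 := rfl
  simp only [gEps] at hne
  rw [if_neg (by linarith), if_neg (by linarith)] at hne
  rw [hG, hp, Real.norm_eq_abs]
  set q := gradient f x i
  have hq : lam + εg ^ (3 / 4 : ℝ) < q ∨ q < -lam - εg ^ (3 / 4 : ℝ) := by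
    by_contra! h
    rw [max_eq_right h.2, min_eq_left h.1, sub_self] at hne
    exact hne rfl
  have e1 : t * (1 / t * q) = q := by field_simp
  have e2 : t * (lam / t) = lam := by field_simp
  have key : ∀ a b : ℝ, a ≤ b → t * a ≤ t * b := fun a b h => mul_le_mul_of_nonneg_left h ht.le
  split_ifs with h1 h2
  · have e : t * (x i - (x i - 1 / t * q - lam / t)) = q + lam := by
      linear_combination e1 + e2
    rw [e]
    rcases hq with hq | hq
    · exact le_trans (by linarith) (le_abs_self _)
    · exact le_trans (by linarith) (neg_le_abs _)
  · have e : t * (x i - (x i - 1 / t * q + lam / t)) = q - lam := by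
      linear_combination e1 - e2
    rw [e]
    rcases hq with hq | hq
    · exact le_trans (by linarith) (le_abs_self _)
    · exact le_trans (by linarith) (neg_le_abs _)
  · have h1' := key _ _ (not_lt.1 h1)
    have h2' := key _ _ (not_lt.1 h2)
    rw [sub_zero]
    rcases hq with hq | hq
    · exact le_trans (by linarith) (le_abs_self _)
    · exact le_trans (by linarith) (neg_le_abs _)

/-- Proximal gradient points with a short step size lie in the level set. -/
theorem exists_proxPoint_mem_levelSet (hlam : 0 < lam) (hf : StandingAssumption f lam x₀)
    (hx : x ∈ levelSet f lam x₀) :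
    ∃ A > 0, ∀ t, A ≤ t → proxPoint f lam t x ∈ levelSet f lam x₀ := by
  obtain ⟨δ, C, hδ, hC, hnear⟩ := hf.taylor_near
  set B := lam * n + ‖gradient f x‖ with hB
  have hB0 : 0 ≤ B := by positivity
  -- `B / δ` keeps the displacement below `δ`, where Taylor applies; the other terms let `t ‖p -
  -- x‖²` dominate the second-order part and its error.
  refine ⟨‖hess f x‖ + C * δ + B / δ + 1, by positivity, fun t ht => ?_⟩
  have hBδ : 0 ≤ B / δ := by positivity
  have hCδ : 0 ≤ C * δ := by positivity
  have hH := norm_nonneg (hess f x)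
  have ht0 : 0 < t := by linarith
  have h1 := norm_proxPoint_sub_le (f := f) (x := x) hlam ht0
  have h2 := proxPoint_ineq (f := f) (x := x) hlam ht0
  set p := proxPoint f lam t x
  have hp : ‖p - x‖ < δ := by
    by_contra! h
    have h3 : t * δ ≤ B := (mul_le_mul_of_nonneg_left h ht0.le).trans h1
    have h4 : B / δ * δ = B := div_mul_cancel₀ _ hδ.ne'
    nlinarith
  have h3 := (abs_le.1 (hnear x hx p hp).2).2
  have h4 : inner ℝ (p - x) (hess f x (p - x)) ≤ ‖hess f x‖ * ‖p - x‖ ^ 2 := by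
    have := mul_le_mul_of_nonneg_left ((hess f x).le_opNorm (p - x)) (norm_nonneg (p - x))
    linarith [real_inner_le_norm (p - x) (hess f x (p - x))]
  have h5 : C * ‖p - x‖ ^ 3 ≤ C * δ * ‖p - x‖ ^ 2 := by
    rw [mul_assoc]
    refine mul_le_mul_of_nonneg_left ?_ hC
    nlinarith [sq_nonneg ‖p - x‖]
  have h6 : (‖hess f x‖ + C * δ) * ‖p - x‖ ^ 2 ≤ t * ‖p - x‖ ^ 2 :=
    mul_le_mul_of_nonneg_right (by linarith) (sq_nonneg _)
  have h7 : 0 ≤ ‖hess f x‖ * ‖p - x‖ ^ 2 := by positivity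
  refine le_trans ?_ (show obj f lam x ≤ obj f lam x₀ from hx)
  unfold obj
  linarith

/-- Inside the level set, the quadratic bound and `proxPoint_ineq` give a decrease `(t - Lg / 2) ‖p
- x‖²`, which beats `ηbar * t ‖p - x‖²` exactly above the stated threshold. Shorter steps satisfy
the threshold too, so the whole path up to `1 / t` stays in the level set. -/
theorem proxPoint_descent (hlam : 0 < lam) (hf : StandingAssumption f lam x₀)
    (hx : x ∈ levelSet f lam x₀) {Lg LH : ℝ} (hs : SmoothnessConstants f lam x₀ Lg LH)
    (P : Params) {εg : ℝ} (hεg : 0 < εg) (hb : ProxBranch f lam εg x) {t : ℝ}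
    (ht : Lg / (2 - 2 * P.ηbar) < t) :
    obj f lam (proxPoint f lam t x)
      < obj f lam x - P.ηbar / t * ‖gradMap f lam t x‖ ^ 2 := by
  obtain ⟨hη0, hη1⟩ := P.ηbar_mem
  have hL0 := hs.Lg_pos
  have hden : 0 < 2 - 2 * P.ηbar := by linarith
  have ht0' : 0 < Lg / (2 - 2 * P.ηbar) := by positivity
  have main : ∀ t, Lg / (2 - 2 * P.ηbar) < t → proxPoint f lam t x ∈ levelSet f lam x₀ →
      obj f lam (proxPoint f lam t x)
        < obj f lam x - P.ηbar / t * ‖gradMap f lam t x‖ ^ 2 := by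
    intro t ht hmem
    have ht0 : 0 < t := ht0'.trans ht
    have h1 := proxPoint_ineq (f := f) (x := x) hlam ht0
    have h2 := hs.upper_quadratic x hx _ hmem Lg le_rfl
    have h3 : 0 < ‖gradMap f lam t x‖ ^ 2 := by
      have := (Real.rpow_pos_of_pos hεg (3 / 4)).trans_le (le_norm_gradMap hlam hb ht0)
      positivity
    rw [norm_gradMap_sq] at h3 ⊢
    have h4 : 0 < ‖proxPoint f lam t x - x‖ ^ 2 := pos_of_mul_pos_right h3 (by positivity)
    rw [show P.ηbar / t * (t ^ 2 * ‖proxPoint f lam t x - x‖ ^ 2)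
      = P.ηbar * t * ‖proxPoint f lam t x - x‖ ^ 2 by field_simp]
    rw [div_lt_iff₀ hden] at ht
    have h5 : (Lg / 2) * ‖proxPoint f lam t x - x‖ ^ 2
        < (t - P.ηbar * t) * ‖proxPoint f lam t x - x‖ ^ 2 :=
      mul_lt_mul_of_pos_right (by linarith) h4
    unfold obj
    linarith
  refine main t ht ?_
  have ht0 : 0 < t := ht0'.trans ht
  rw [proxPoint_eq_proxPath hlam ht0]
  refine le_of_forall_lt_of_le (F := fun s => obj f lam (proxPath f lam x s)) (T := 1 / t)
    (hf.continuous_obj.comp continuous_proxPath) (fun s hs0 hsT hle => ?_) ?_ (by positivity) le_rfl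
  · have hts : t ≤ 1 / s := by rwa [le_div_comm₀ ht0 hs0]
    have e : proxPath f lam x s = proxPoint f lam (1 / s) x := by
      rw [proxPoint_eq_proxPath hlam (by positivity), one_div_one_div]
    simp only [e] at hle ⊢
    have h1 := main (1 / s) (ht.trans_le hts) hle
    have h2 : 0 ≤ P.ηbar / (1 / s) * ‖gradMap f lam (1 / s) x‖ ^ 2 := by positivity
    have h3 : obj f lam x ≤ obj f lam x₀ := hx
    linarith
  · obtain ⟨A, hA, h⟩ := exists_proxPoint_mem_levelSet hlam hf hx
    refine ⟨1 / A, by positivity, fun s hs0 hsA => ?_⟩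
    have e : proxPath f lam x s = proxPoint f lam (1 / s) x := by
      rw [proxPoint_eq_proxPath hlam (by positivity), one_div_one_div]
    simp only [e]
    exact h _ (by rwa [le_div_comm₀ hA hs0])

theorem exists_proxSearch (hlam : 0 < lam) (hf : StandingAssumption f lam x₀)
    (hx : x ∈ levelSet f lam x₀) {Lg LH : ℝ} (hs : SmoothnessConstants f lam x₀ Lg LH)
    (P : Params) {εg : ℝ} (hεg : 0 < εg) (hb : ProxBranch f lam εg x) :
    ∃ j, ProxSearch f lam P x j := by
  obtain ⟨j, hj⟩ := pow_unbounded_of_one_lt (Lg / (2 - 2 * P.ηbar)) P.one_lt_β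
  exact ⟨j, proxPoint_descent hlam hf hx hs P hεg hb hj⟩

theorem cPG_pos (P : Params) (Lg : ℝ) : 0 < cPG P Lg :=
  div_pos P.ηbar_mem.1 (lt_max_of_lt_right one_pos)

theorem ProxStep.decrease (hlam : 0 < lam) (hf : StandingAssumption f lam x₀)
    (hx : x ∈ levelSet f lam x₀) {Lg LH : ℝ} (hs : SmoothnessConstants f lam x₀ Lg LH)
    {P : Params} {εg : ℝ} (hεg : 0 < εg) (hb : ProxBranch f lam εg x) {x' : E n}
    (h : ProxStep f lam P x x') :
    obj f lam x' ≤ obj f lam x - cPG P Lg * εg ^ (3 / 2 : ℝ) := by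
  obtain ⟨j, ⟨hj, hmin⟩, rfl⟩ := h
  have hβ := P.one_lt_β
  have hη := P.ηbar_mem
  have hle : P.β ^ j ≤ max (P.β * Lg / (2 - 2 * P.ηbar)) 1 := by
    cases j with
    | zero => simp
    | succ j =>
      -- The previous trial failed, so it lay below the threshold of `proxPoint_descent`.
      have h1 : P.β ^ j ≤ Lg / (2 - 2 * P.ηbar) := by
        by_contra! hlt
        have : j + 1 ≤ j := hmin (proxPoint_descent hlam hf hx hs P hεg hb hlt)
        omega
      refine le_max_of_le_left ?_
      rw [pow_succ, mul_comm, mul_div_assoc]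
      exact mul_le_mul_of_nonneg_left h1 (by linarith)
  have hpos : 0 < P.β ^ j := by positivity
  have h1 : cPG P Lg ≤ P.ηbar / P.β ^ j :=
    div_le_div_of_nonneg_left hη.1.le hpos hle
  have h2 : εg ^ (3 / 2 : ℝ) ≤ ‖gradMap f lam (P.β ^ j) x‖ ^ 2 := by
    have := pow_le_pow_left₀ (by positivity) (le_norm_gradMap hlam hb hpos) 2
    rwa [← Real.rpow_natCast, ← Real.rpow_mul hεg.le,
      show (3 / 4 : ℝ) * (2 : ℕ) = 3 / 2 by norm_num] at this
  have h3 := mul_le_mul h1 h2 (by positivity) ((cPG_pos P Lg).le.trans h1)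
  exact hj.le.trans (by linarith)

end ProxStep

/-! ### Restriction to an index set and extension by zero. -/

section Subvectors

variable {n : ℕ} (J : Finset (Fin n))

theorem ext_apply_of_notMem (d : EuclideanSpace ℝ J) {i : Fin n} (hi : i ∉ J) : ext J d i = 0 :=
  dif_neg hi

theorem sub_ext (d : EuclideanSpace ℝ J) : sub J (ext J d) = d := by
  ext i
  exact dif_pos i.2

theorem inner_ext_right (x : E n) (d : EuclideanSpace ℝ J) :
    inner ℝ x (ext J d) = inner ℝ (sub J x) d := by
  simp only [PiLp.inner_apply]
  rw [← Finset.sum_subset (Finset.subset_univ J) (fun i _ hi => by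
    rw [ext_apply_of_notMem J d hi, inner_zero_right]), ← Finset.sum_coe_sort J]
  refine Finset.sum_congr rfl fun i _ => ?_
  rw [show ext J d i = d i from dif_pos i.2]
  rfl

theorem norm_ext (d : EuclideanSpace ℝ J) : ‖ext J d‖ = ‖d‖ := by
  rw [← sq_eq_sq₀ (norm_nonneg _) (norm_nonneg _), ← real_inner_self_eq_norm_sq, inner_ext_right,
    sub_ext, real_inner_self_eq_norm_sq]

theorem norm_sub_le_norm_sub_of_subset {J K : Finset (Fin n)} (hJK : J ⊆ K) {x y : E n}
    (h : ∀ i ∈ J, x i = y i) : ‖sub J x‖ ≤ ‖sub K y‖ := by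
  rw [← sq_le_sq₀ (norm_nonneg _) (norm_nonneg _), EuclideanSpace.real_norm_sq_eq,
    EuclideanSpace.real_norm_sq_eq]
  change ∑ i : J, x i ^ 2 ≤ ∑ i : K, y i ^ 2
  rw [Finset.sum_coe_sort J fun i => x i ^ 2, Finset.sum_coe_sort K fun i => y i ^ 2,
    Finset.sum_congr rfl fun i hi => by rw [h i hi]]
  exact Finset.sum_le_sum_of_subset_of_nonneg hJK fun _ _ _ => sq_nonneg _

theorem norm_sub_le_norm (x : E n) : ‖sub J x‖ ≤ ‖x‖ := by
  rw [← sq_le_sq₀ (norm_nonneg _) (norm_nonneg _), EuclideanSpace.real_norm_sq_eq,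
    EuclideanSpace.real_norm_sq_eq]
  change ∑ i : J, x i ^ 2 ≤ _
  rw [Finset.sum_coe_sort J fun i => x i ^ 2]
  exact Finset.sum_le_sum_of_subset_of_nonneg (Finset.subset_univ J) fun _ _ _ => sq_nonneg _

theorem inner_subOp (A : E n →ₗ[ℝ] E n) (d e : EuclideanSpace ℝ J) :
    inner ℝ d (subOp J A e) = inner ℝ (ext J d) (A (ext J e)) := by
  rw [real_inner_comm, real_inner_comm (A (ext J e)), inner_ext_right]
  rfl

end Subvectors

/-! ### The Newton-CG step. -/

section NewtonStep

variable {n : ℕ} {f : E n → ℝ} {lam εg εh : ℝ} {x₀ x : E n}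

/-- A step this short changes no sign among the large coordinates, so the `ℓ₁`-norm is linear along
it and `gEps` acts as the gradient of the objective. -/
theorem obj_add (hεg : 0 < εg) {s : E n} (hs : ∀ i ∉ bigIdx εg x, s i = 0)
    (hn : ‖s‖ ≤ εg ^ (1 / 2 : ℝ)) :
    obj f lam (x + s) = obj f lam x + (f (x + s) - f x - inner ℝ (gradient f x) s)
      + inner ℝ (gEps f lam εg x) s := by
  have hr : 0 < εg ^ (1 / 2 : ℝ) := Real.rpow_pos_of_pos hεg _
  have h : inner ℝ (gEps f lam εg x) s
      = inner ℝ (gradient f x) s + lam * (l1 (x + s) - l1 x) := by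
    simp only [PiLp.inner_apply, l1]
    rw [← Finset.sum_sub_distrib, Finset.mul_sum, ← Finset.sum_add_distrib]
    refine Finset.sum_congr rfl fun i _ => ?_
    by_cases hi : i ∈ bigIdx εg x
    · have hi' : εg ^ (1 / 2 : ℝ) < |x i| := (Finset.mem_filter.1 hi).2
      have hsi := abs_le.1 ((PiLp.norm_apply_le s i).trans hn)
      simp only [gEps, PiLp.add_apply, RCLike.inner_apply, conj_trivial]
      rcases lt_abs.1 hi' with h | h
      · rw [if_pos h, abs_of_pos (by linarith : 0 < x i), abs_of_nonneg (by linarith)]; ring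
      · rw [if_neg (by linarith), if_pos (by linarith), abs_of_neg (by linarith : x i < 0),
          abs_of_nonpos (by linarith)]; ring
    · simp [hs i hi]
  rw [h]
  unfold obj
  ring

/-- Descent along a direction supported on the large coordinates. -/
theorem obj_lt_of_curvature (hf : StandingAssumption f lam x₀) (hx : x ∈ levelSet f lam x₀)
    {Lg LH : ℝ} (hs : SmoothnessConstants f lam x₀ Lg LH) (hεg : 0 < εg) (hεh : 0 < εh)
    {η : ℝ} (hη : 0 < η) {D : E n} (hD : D ≠ 0) (hsupp : ∀ i ∉ bigIdx εg x, D i = 0)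
    (hmodel : ∀ t : ℝ, 0 < t → t ≤ 1 → t * inner ℝ (gEps f lam εg x) D
      + t ^ 2 / 2 * inner ℝ D (hess f x D) ≤ -(1 / 2 * t ^ 2 * εh * ‖D‖ ^ 2))
    {t : ℝ} (ht : 0 < t) (ht1 : t ≤ 1) (hsign : t * ‖D‖ ≤ εg ^ (1 / 2 : ℝ))
    (hstep : LH * (t * ‖D‖) < 3 * (1 - 2 * η) * εh) :
    obj f lam (x + t • D) < obj f lam x - η * t ^ 2 * εh * ‖D‖ ^ 2 := by
  have hDn : 0 < ‖D‖ := norm_pos_iff.2 hD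
  have hLH := hs.LH_pos
  have hnorm : ∀ s : ℝ, 0 < s → ‖s • D‖ = s * ‖D‖ := fun s h => by
    rw [norm_smul, Real.norm_of_nonneg h.le]
  have hobj : ∀ s : ℝ, 0 < s → s ≤ t → ∀ R : ℝ,
      f (x + s • D) - f x - inner ℝ (gradient f x) (s • D)
        - 1 / 2 * inner ℝ (s • D) (hess f x (s • D)) ≤ R →
      obj f lam (x + s • D) ≤ obj f lam x + R - 1 / 2 * s ^ 2 * εh * ‖D‖ ^ 2 := by
    intro s hs0 hst R hR
    have h1 := obj_add (f := f) (lam := lam) (x := x) (s := s • D) hεg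
      (fun i hi => by simp [hsupp i hi])
      ((hnorm s hs0).trans_le ((mul_le_mul_of_nonneg_right hst hDn.le).trans hsign))
    have h2 := hmodel s hs0 (hst.trans ht1)
    rw [h1, inner_smul_right (gEps f lam εg x) D s]
    rw [map_smul, inner_smul_left, inner_smul_right D _ s] at hR
    simp only [conj_trivial] at hR
    linarith
  -- The model gain `s² εh ‖D‖² / 2` less the cubic error `LH (s ‖D‖)³ / 6` exceeds the required
  -- decrease precisely under `hstep`.
  have main : ∀ s : ℝ, 0 < s → s ≤ t → obj f lam (x + s • D) ≤ obj f lam x₀ →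
      obj f lam (x + s • D) < obj f lam x - η * s ^ 2 * εh * ‖D‖ ^ 2 := by
    intro s hs0 hst hmem
    have h1 := hs.upper_cubic x hx (x + s • D) hmem
    rw [add_sub_cancel_left, hnorm s hs0] at h1
    have h2 := hobj s hs0 hst (LH / 6 * (s * ‖D‖) ^ 3) (by linarith)
    have h3 : LH * (s * ‖D‖) < 3 * (1 - 2 * η) * εh :=
      (mul_le_mul_of_nonneg_left (mul_le_mul_of_nonneg_right hst hDn.le) hLH.le).trans_lt hstep
    have h4 : 0 < (s * ‖D‖) ^ 2 := by positivity
    have h5 := mul_lt_mul_of_pos_right h3 h4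
    linarith
  refine main t ht le_rfl ?_
  refine le_of_forall_lt_of_le (F := fun s => obj f lam (x + s • D)) (T := t)
    (hf.continuous_obj.comp (by fun_prop)) (fun s hs0 hst hle => ?_) ?_ ht le_rfl
  · have h1 := main s hs0 hst hle
    have h2 : 0 ≤ η * s ^ 2 * εh * ‖D‖ ^ 2 := by positivity
    have h3 : obj f lam x ≤ obj f lam x₀ := hx
    linarith
  -- Membership in the level set is not yet known here, so the local constant `C` replaces `LH`.
  · obtain ⟨δ, C, hδ, hC, hnear⟩ := hf.taylor_near
    refine ⟨min t (min (δ / (2 * ‖D‖)) (εh / (2 * (C * ‖D‖ + 1)))), by positivity,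
      fun s hs0 hle => ?_⟩
    obtain ⟨hst, hle⟩ := le_min_iff.1 hle
    obtain ⟨h1, h2⟩ := le_min_iff.1 hle
    rw [le_div_iff₀ (by positivity)] at h1 h2
    have h3 := (abs_le.1 (hnear x hx (x + s • D)
      (by rw [add_sub_cancel_left, hnorm s hs0]; linarith)).2).2
    rw [add_sub_cancel_left, hnorm s hs0] at h3
    have h4 := hobj s hs0 hst _ h3
    have h5 : C * (s * ‖D‖) ≤ εh / 2 := by linarith
    have h6 : 0 ≤ (s * ‖D‖) ^ 2 := by positivity
    have h7 := mul_le_mul_of_nonneg_right h5 h6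
    have h8 : obj f lam x ≤ obj f lam x₀ := hx
    change obj f lam (x + s • D) ≤ _
    linarith

/-- The guaranteed progress, up to the constant factor. -/
def progress (εg εh : ℝ) : ℝ :=
  min (min (εg * εh) (εh ^ 3)) (min (εg ^ 2 / εh) (εg ^ (3 / 2 : ℝ)))

theorem progress_pos (hεg : 0 < εg) (hεh : 0 < εh) : 0 < progress εg εh := by
  unfold progress; positivity

theorem Params.η_lt (P : Params) : P.η < 1 / 2 := by
  have := P.η_mem.2
  have := P.ζ_mem.1
  linarith

theorem cNC_pos (P : Params) {LH : ℝ} (hLH : 0 < LH) : 0 < cNC P LH := by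
  have h1 := P.η_mem.1
  have h2 := P.θ_mem.1
  have h3 : 0 < 1 - 2 * P.η := by linarith [P.η_lt]
  unfold cNC; positivity

theorem cSOL_pos (P : Params) {LH : ℝ} (hLH : 0 < LH) : 0 < cSOL P LH := by
  have h1 := P.η_mem
  have h2 := P.θ_mem.1
  have h3 := P.ζ_mem
  have h4 := P.one_le_τhat
  have h5 : 0 < 1 - P.ζ - 2 * P.η := by linarith [h1.2]
  have h6 : 0 < 1 - P.ζ := by linarith [h3.2]
  have h7 : 0 < P.ζ + 4 * P.τhat := by linarith [h3.1]
  have h8 : 0 < max (LH / 3) (2 * P.η) := lt_max_of_lt_left (by positivity)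
  have h9 := h1.1
  unfold cSOL; positivity

theorem cMin_pos (P : Params) (Lg : ℝ) {LH : ℝ} (hLH : 0 < LH) : 0 < cMin P Lg LH :=
  lt_min (cNC_pos P hLH) (lt_min (cPG_pos P Lg) (cSOL_pos P hLH))

theorem cMin_mul_progress_le (P : Params) {Lg LH c m : ℝ} (hLH : 0 < LH) (hεg : 0 < εg)
    (hεh : 0 < εh) (hc : cMin P Lg LH ≤ c) (hm : progress εg εh ≤ m) :
    cMin P Lg LH * progress εg εh ≤ c * m :=
  mul_le_mul hc hm (progress_pos hεg hεh).le ((cMin_pos P Lg hLH).le.trans hc)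

theorem rpow_half_sq (hεg : 0 < εg) : (εg ^ (1 / 2 : ℝ)) ^ 2 = εg := by
  rw [← Real.rpow_natCast, ← Real.rpow_mul hεg.le]; norm_num

theorem cNC_le (P : Params) (LH : ℝ) : cNC P LH ≤ P.η ∧ cNC P LH ≤ P.η * P.θ ^ 2 ∧
    cNC P LH ≤ P.η * P.θ ^ 2 * (9 * (1 - 2 * P.η) ^ 2 / LH ^ 2) := by
  have h1 := P.η_mem.1
  have h2 := P.θ_mem
  have h3 : 0 ≤ P.η * P.θ ^ 2 := by positivity
  have h4 := mul_le_mul_of_nonneg_left (min_le_left 1 (9 * (1 - 2 * P.η) ^ 2 / LH ^ 2)) h3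
  have h5 := mul_le_mul_of_nonneg_left (min_le_right 1 (9 * (1 - 2 * P.η) ^ 2 / LH ^ 2)) h3
  have h6 : P.θ ^ 2 ≤ 1 := pow_le_one₀ h2.1.le h2.2.le
  refine ⟨?_, ?_, h5⟩
  · unfold cNC; nlinarith
  · unfold cNC; linarith

/-- The directions along which the line search of the Newton-CG step is carried out. -/
structure IsDescentDir (f : E n → ℝ) (lam εg εh : ℝ) (x D : E n) : Prop where
  ne_zero : D ≠ 0
  supp : ∀ i ∉ bigIdx εg x, D i = 0
  model : ∀ t : ℝ, 0 < t → t ≤ 1 → t * inner ℝ (gEps f lam εg x) D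
      + t ^ 2 / 2 * inner ℝ D (hess f x D) ≤ -(1 / 2 * t ^ 2 * εh * ‖D‖ ^ 2)

section

variable (hf : StandingAssumption f lam x₀) (hx : x ∈ levelSet f lam x₀)
  {Lg LH : ℝ} (hs : SmoothnessConstants f lam x₀ Lg LH) (hεg : 0 < εg) (hεh : 0 < εh)
  {P : Params} {D : E n} (hD : IsDescentDir f lam εg εh x D)

include hf hx hs hεg hεh hD

theorem IsDescentDir.newtonSearch {j : ℕ} (h1 : P.θ ^ j * ‖D‖ ≤ εg ^ (1 / 2 : ℝ))
    (h2 : LH * (P.θ ^ j * ‖D‖) < 3 * (1 - 2 * P.η) * εh) : NewtonSearch f lam εh P x D j := by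
  have h := obj_lt_of_curvature hf hx hs hεg hεh P.η_mem.1 hD.ne_zero hD.supp hD.model
    (pow_pos P.θ_mem.1 j) (pow_le_one₀ P.θ_mem.1.le P.θ_mem.2.le) h1 h2
  rwa [← pow_mul, mul_comm j 2] at h

theorem IsDescentDir.exists_newtonSearch : ∃ j, NewtonSearch f lam εh P x D j := by
  have h1 : Filter.Tendsto (fun j : ℕ => P.θ ^ j * ‖D‖) Filter.atTop (nhds 0) := by
    simpa using (tendsto_pow_atTop_nhds_zero_of_lt_one P.θ_mem.1.le P.θ_mem.2).mul_const ‖D‖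
  have h2 : Filter.Tendsto (fun j : ℕ => LH * (P.θ ^ j * ‖D‖)) Filter.atTop (nhds 0) := by
    simpa using h1.const_mul LH
  have hη : 0 < 1 - 2 * P.η := by linarith [P.η_lt]
  obtain ⟨j, h3, h4⟩ := ((h1.eventually_lt_const (Real.rpow_pos_of_pos hεg (1 / 2))).and
    (h2.eventually_lt_const (show 0 < 3 * (1 - 2 * P.η) * εh by positivity))).exists
  exact ⟨j, hD.newtonSearch hf hx hs hεg hεh h3.le h4⟩

/-- After backtracking, the preceding trial failed, so its length exceeded `√εg` or was at least `3
(1 - 2η) εh / LH`; one factor `θ` is lost. Unit steps need a separate argument. -/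
theorem IsDescentDir.decrease {j : ℕ} (hj : IsLeast {j | NewtonSearch f lam εh P x D j} j) :
    j = 0 ∨ obj f lam (x + P.θ ^ j • D) ≤ obj f lam x - cMin P Lg LH * progress εg εh := by
  obtain ⟨hj, hmin⟩ := hj
  cases j with
  | zero => exact Or.inl rfl
  | succ j =>
    right
    have hLH := hs.LH_pos
    have hη0 := P.η_mem.1
    have hθ := P.θ_mem.1
    have hη : 0 < 1 - 2 * P.η := by linarith [P.η_lt]
    have hnot : ¬ NewtonSearch f lam εh P x D j := fun h => by
      have : j + 1 ≤ j := hmin h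
      omega
    obtain ⟨-, hc2, hc3⟩ := cNC_le P LH
    have hval : P.η * P.θ ^ (2 * (j + 1)) * εh * ‖D‖ ^ 2
        = P.η * P.θ ^ 2 * εh * (P.θ ^ j * ‖D‖) ^ 2 := by ring
    refine le_trans (le_of_lt hj) (sub_le_sub_left ?_ _)
    rw [hval]
    by_cases h1 : P.θ ^ j * ‖D‖ ≤ εg ^ (1 / 2 : ℝ)
    · have h2 : 3 * (1 - 2 * P.η) * εh ≤ LH * (P.θ ^ j * ‖D‖) := by
        by_contra! h
        exact hnot (hD.newtonSearch hf hx hs hεg hεh h1 h)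
      refine (cMin_mul_progress_le P hLH hεg hεh ((min_le_left _ _).trans hc3)
        ((min_le_left _ _).trans (min_le_right _ _))).trans ?_
      have h3 : (3 * (1 - 2 * P.η) * εh / LH) ^ 2 ≤ (P.θ ^ j * ‖D‖) ^ 2 := by
        refine pow_le_pow_left₀ (by positivity) ?_ 2
        rw [div_le_iff₀ hLH]; linarith
      have h4 := mul_le_mul_of_nonneg_left h3 (show 0 ≤ P.η * P.θ ^ 2 * εh by positivity)
      refine le_trans (le_of_eq ?_) h4
      field_simp; ring
    · refine (cMin_mul_progress_le P hLH hεg hεh ((min_le_left _ _).trans hc2)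
        ((min_le_left _ _).trans (min_le_left _ _))).trans ?_
      have h3 := pow_le_pow_left₀ (Real.rpow_nonneg hεg.le _) (not_le.1 h1).le 2
      rw [rpow_half_sq hεg] at h3
      have h4 := mul_le_mul_of_nonneg_left h3 (show 0 ≤ P.η * P.θ ^ 2 * εh by positivity)
      linarith

end

/-- Solution of the quadratic inequality that bounds the length of unit steps from below. -/
theorem le_of_quadratic {b L u : ℝ} (hb : 0 < b) (hL : 0 < L) (hu : 0 ≤ u) (hεg : 0 < εg)
    (hεh : 0 < εh) (h : 2 * εg < b * εh * u + L * u ^ 2) :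
    4 / (√(b ^ 2 + 8 * L) + b) * min (εg / εh) εh ≤ u := by
  by_contra! hlt
  set R := √(b ^ 2 + 8 * L) with hR
  have hR0 : 0 ≤ R := Real.sqrt_nonneg _
  have hR2 : R ^ 2 = b ^ 2 + 8 * L := Real.sq_sqrt (by positivity)
  set v := min (εg / εh) εh
  have hv0 : 0 < v := by positivity
  have hv1 : v * εh ≤ εg := by
    have := min_le_left (εg / εh) εh
    rwa [le_div_iff₀ hεh] at this
  have hv2 : v ≤ εh := min_le_right _ _
  set C := 4 / (R + b) with hC
  have hC0 : 0 < C := by positivity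
  -- `C` is the positive root of this quadratic, written with the radical in the denominator.
  have hC2 : b * C + L * C ^ 2 = 2 := by
    rw [hC, show L = (R ^ 2 - b ^ 2) / 8 by linarith]
    field_simp
    ring
  have h1 : u ^ 2 ≤ C ^ 2 * (v * εh) := by
    have h2 : u ^ 2 ≤ (C * v) ^ 2 := pow_le_pow_left₀ hu hlt.le 2
    have h3 : C ^ 2 * (v * v) ≤ C ^ 2 * (v * εh) := by gcongr
    linarith
  have h4 : b * εh * u ≤ b * εh * (C * v) := by gcongr
  have h5 : L * u ^ 2 ≤ L * (C ^ 2 * (v * εh)) := by gcongr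
  have h6 : (b * C + L * C ^ 2) * (v * εh) ≤ 2 * εg := by rw [hC2]; linarith
  linarith

theorem progress_le_min_sq (hεg : 0 < εg) (hεh : 0 < εh) :
    progress εg εh ≤ εh * min (εg / εh) εh ^ 2 := by
  rcases min_choice (εg / εh) εh with h | h <;> rw [h]
  · refine ((min_le_right _ _).trans (min_le_left _ _)).trans (le_of_eq ?_)
    field_simp
  · refine ((min_le_left _ _).trans (min_le_right _ _)).trans (le_of_eq ?_)
    ring

section

variable (hf : StandingAssumption f lam x₀) (hx : x ∈ levelSet f lam x₀)
  (hεg : 0 < εg) (hεh : 0 < εh) {P : Params} (hb : NewtonBranch f lam εg x) {τ M : ℝ}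
  (hτ : τ ∈ tauRange f lam εg εh P x)

include hεg hb in
theorem newtonInput_g_norm_pos : 0 < ‖(newtonInput f lam εg εh P x τ M).g‖ := hεg.trans hb.2.2

include hf hx in
theorem newtonInput_H_isSymmetric : (newtonInput f lam εg εh P x τ M).H.IsSymmetric := by
  intro v w
  change inner ℝ (subOp _ _ v) w = inner ℝ v (subOp _ _ w)
  rw [real_inner_comm, inner_subOp, inner_subOp, real_inner_comm]
  exact inner_hess_comm (hf.contDiffAt hx) _ _

include hεg hb hτ in
-- The range of `τ` is chosen so that the power of the gradient norm cancels in the shift.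
theorem newtonInput_c_mem : 2 * εh ≤ (newtonInput f lam εg εh P x τ M).c ∧
    (newtonInput f lam εg εh P x τ M).c ≤ 2 * P.τhat * εh := by
  have hg := newtonInput_g_norm_pos (εh := εh) (P := P) (τ := τ) (M := M) hεg hb
  have hpos : 0 < ‖sub (bigIdx εg x) (gEps f lam εg x)‖ ^ P.δ := Real.rpow_pos_of_pos hg _
  exact ⟨(div_le_iff₀ hpos).1 hτ.1, (le_div_iff₀ hpos).1 hτ.2⟩

include hf hx hεg hεh hb hτ

theorem newtonInput_exists_returns :
    ∃ d ty, (newtonInput f lam εg εh P x τ M).Returns d ty :=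
  CCGInput.exists_returns (newtonInput_H_isSymmetric hf hx)
    (norm_pos_iff.1 (newtonInput_g_norm_pos hεg hb)) hεh
    (by linarith [(newtonInput_c_mem (M := M) hεg hb hτ).1]) P.ζ_mem.1

theorem newtonInput_approx_solution {d : EuclideanSpace ℝ (bigIdx εg x)}
    (h : (newtonInput f lam εg εh P x τ M).Returns d DType.SOL) :
    d ≠ 0 ∧ εh * ‖d‖ ^ 2 ≤ inner ℝ d ((newtonInput f lam εg εh P x τ M).Hb d) ∧
      inner ℝ (sub (bigIdx εg x) (gEps f lam εg x)) d
        = -inner ℝ d ((newtonInput f lam εg εh P x τ M).Hb d) ∧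
      ‖sub (bigIdx εg x) (gEps f lam εg x) + (newtonInput f lam εg εh P x τ M).Hb d‖
        ≤ P.ζ * εh / 2 * ‖d‖ :=
  h.approx_solution (newtonInput_H_isSymmetric hf hx)
    (norm_pos_iff.1 (newtonInput_g_norm_pos hεg hb)) hεh
    (by linarith [(newtonInput_c_mem (M := M) hεg hb hτ).1]) P.ζ_mem.1 P.ζ_mem.2

/-- With `b = ⟨d, Hb d⟩` the slope is `-b` and the curvature at most `b`, so for `t ≤ 1` the model
is at most `-t² b / 2`, and `b ≥ εh ‖d‖²`. -/
theorem isDescentDir_of_sol {d : EuclideanSpace ℝ (bigIdx εg x)}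
    (h : (newtonInput f lam εg εh P x τ M).Returns d DType.SOL) :
    IsDescentDir f lam εg εh x (ext (bigIdx εg x) d) := by
  obtain ⟨h0, h1, h2, -⟩ := newtonInput_approx_solution hf hx hεg hεh hb hτ h
  have hc := (newtonInput_c_mem (M := M) hεg hb hτ).1
  have hHb : inner ℝ d ((newtonInput f lam εg εh P x τ M).Hb d)
      = inner ℝ (ext (bigIdx εg x) d) (hess f x (ext (bigIdx εg x) d))
        + (newtonInput f lam εg εh P x τ M).c * ‖d‖ ^ 2 := by
    rw [CCGInput.Hb_apply, inner_add_right, inner_smul_right, real_inner_self_eq_norm_sq]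
    congr 1
    exact inner_subOp _ _ _ _
  refine ⟨fun h => h0 ?_, fun i hi => ext_apply_of_notMem _ _ hi, fun t ht ht1 => ?_⟩
  · rw [← norm_eq_zero, ← norm_ext, h, norm_zero]
  · rw [inner_ext_right, h2, norm_ext]
    set b := inner ℝ d ((newtonInput f lam εg εh P x τ M).Hb d)
    set c := (newtonInput f lam εg εh P x τ M).c
    have h3 : t ^ 2 / 2 * (εh * ‖d‖ ^ 2) ≤ t ^ 2 / 2 * b :=
      mul_le_mul_of_nonneg_left h1 (by positivity)
    have hb0 : 0 ≤ b := le_trans (by positivity) h1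
    have h4 : t ^ 2 * b ≤ t * b := mul_le_mul_of_nonneg_right (by nlinarith) hb0
    have h5 : 0 ≤ t ^ 2 / 2 * (c * ‖d‖ ^ 2) := by
      have : 0 ≤ c := by linarith
      positivity
    have h6 : inner ℝ (ext (bigIdx εg x) d) (hess f x (ext (bigIdx εg x) d))
      = b - c * ‖d‖ ^ 2 := by linarith
    rw [h6]
    linarith

omit hf hx in
-- The shift is at least `2 εh`, so shifted curvature below `εh` means true curvature at most `-εh`.
-- Scaling to length `ρ`, the absolute curvature, gives the quadratic form the value `-ρ³`; the sign
-- makes the slope nonpositive.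
theorem isDescentDir_of_nc {d : EuclideanSpace ℝ (bigIdx εg x)}
    (h : (newtonInput f lam εg εh P x τ M).Returns d DType.NC) :
    IsDescentDir f lam εg εh x (newtonDir f lam εg x d DType.NC) ∧
      εh ≤ ‖newtonDir f lam εg x d DType.NC‖ := by
  have hlow := h.lowCurv
  have hc := (newtonInput_c_mem (M := M) hεg hb hτ).1
  have hHb : inner ℝ d ((newtonInput f lam εg εh P x τ M).Hb d)
      = inner ℝ d (subOp (bigIdx εg x) (hess f x).toLinearMap d)
        + (newtonInput f lam εg εh P x τ M).c * ‖d‖ ^ 2 := by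
    rw [CCGInput.Hb_apply, inner_add_right, inner_smul_right, real_inner_self_eq_norm_sq]
    rfl
  have hlow' : inner ℝ d (subOp (bigIdx εg x) (hess f x).toLinearMap d)
      + (newtonInput f lam εg εh P x τ M).c * ‖d‖ ^ 2 < εh * ‖d‖ ^ 2 := hHb ▸ hlow
  have hd : 0 < ‖d‖ := by
    rcases (norm_nonneg d).eq_or_lt with h0 | h0
    · rw [norm_eq_zero.1 h0.symm] at hlow'
      simp at hlow'
    · exact h0
  have hd2 : 0 < ‖d‖ ^ 2 := by positivity
  simp only [newtonDir]
  set q := inner ℝ d (subOp (bigIdx εg x) (hess f x).toLinearMap d) with hq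
  set σ := sgn (inner ℝ d (sub (bigIdx εg x) (gEps f lam εg x))) with hσ
  have hq1 : q ≤ -(εh * ‖d‖ ^ 2) := by
    have := mul_le_mul_of_nonneg_right hc hd2.le
    linarith
  have hq0 : q < 0 := hq1.trans_lt (neg_neg_of_pos (by positivity))
  have hσabs : |σ| = 1 := by rw [hσ, sgn]; split_ifs <;> simp
  have hσg : 0 ≤ σ * inner ℝ d (sub (bigIdx εg x) (gEps f lam εg x)) := by
    rw [hσ, sgn]; split_ifs with h
    · simpa using h
    · have := (not_le.1 h).le
      linarith
  set ρ := |q| / ‖d‖ ^ 2 with hρ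
  have hρq : q = -(ρ * ‖d‖ ^ 2) := by
    rw [hρ, div_mul_cancel₀ _ hd2.ne', abs_of_neg hq0, neg_neg]
  have hρh : εh ≤ ρ := by
    rw [hρ, le_div_iff₀ hd2, abs_of_neg hq0]; linarith
  have hnorm : ‖ext (bigIdx εg x) ((-σ * ρ) • (1 / ‖d‖) • d)‖ = ρ := by
    rw [norm_ext, norm_smul, norm_smul, Real.norm_eq_abs, abs_mul, abs_neg, hσabs,
      abs_of_pos (hεh.trans_le hρh), Real.norm_of_nonneg (by positivity)]
    field_simp
  refine ⟨⟨fun h0 => ?_, fun i hi => ext_apply_of_notMem _ _ hi, fun t ht ht1 => ?_⟩,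
    hρh.trans_eq hnorm.symm⟩
  · rw [h0, norm_zero] at hnorm
    linarith
  · rw [hnorm]
    have e1 : inner ℝ (gEps f lam εg x) (ext (bigIdx εg x) ((-σ * ρ) • (1 / ‖d‖) • d))
        = -(ρ / ‖d‖ * (σ * inner ℝ d (sub (bigIdx εg x) (gEps f lam εg x)))) := by
      rw [inner_ext_right, inner_smul_right, inner_smul_right, real_inner_comm]
      ring
    have hσsq : σ ^ 2 = 1 := by rw [← sq_abs, hσabs, one_pow]
    have e2 : inner ℝ (ext (bigIdx εg x) ((-σ * ρ) • (1 / ‖d‖) • d))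
        (hess f x (ext (bigIdx εg x) ((-σ * ρ) • (1 / ‖d‖) • d))) = -ρ ^ 3 := by
      have e3 : inner ℝ (ext (bigIdx εg x) d) (hess f x (ext (bigIdx εg x) d)) = q :=
        (inner_subOp _ _ _ _).symm
      simp only [map_smul, inner_smul_left, inner_smul_right, conj_trivial, e3]
      rw [hρq]
      field_simp
      rw [hσsq, one_mul]
    rw [e1, e2]
    have h1 : 0 ≤ t * (ρ / ‖d‖ * (σ * inner ℝ d (sub (bigIdx εg x) (gEps f lam εg x)))) := by
      have : 0 ≤ ρ := hεh.le.trans hρh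
      positivity
    have h2 := mul_le_mul_of_nonneg_right hρh (show 0 ≤ t ^ 2 / 2 * ρ ^ 2 by positivity)
    linarith

theorem isDescentDir_newtonDir {d : EuclideanSpace ℝ (bigIdx εg x)} {ty : DType}
    (h : (newtonInput f lam εg εh P x τ M).Returns d ty) :
    IsDescentDir f lam εg εh x (newtonDir f lam εg x d ty) := by
  cases ty with
  | SOL => exact isDescentDir_of_sol hf hx hεg hεh hb hτ h
  | NC => exact (isDescentDir_of_nc hεg hεh hb hτ h).1

/-- The gradient after a short unit step along an approximate Newton direction. -/
theorem norm_gEps_unit_step_le {Lg LH : ℝ} (hs : SmoothnessConstants f lam x₀ Lg LH)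
    {d : EuclideanSpace ℝ (bigIdx εg x)}
    (h : (newtonInput f lam εg εh P x τ M).Returns d DType.SOL)
    (hmem : x + ext (bigIdx εg x) d ∈ levelSet f lam x₀) (hd : ‖d‖ ≤ εg ^ (1 / 2 : ℝ)) :
    2 * ‖sub (bigIdx εg (x + ext (bigIdx εg x) d)) (gEps f lam εg (x + ext (bigIdx εg x) d))‖
      ≤ (P.ζ + 4 * P.τhat) * εh * ‖d‖ + LH * ‖d‖ ^ 2 := by
  obtain ⟨-, -, -, hres⟩ := newtonInput_approx_solution hf hx hεg hεh hb hτ h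
  obtain ⟨hc1, hc2⟩ := newtonInput_c_mem (M := M) hεg hb hτ
  set c := (newtonInput f lam εg εh P x τ M).c with hc
  set D := ext (bigIdx εg x) d with hD
  have hr : 0 < εg ^ (1 / 2 : ℝ) := Real.rpow_pos_of_pos hεg _
  have hDn : ‖D‖ = ‖d‖ := norm_ext _ _
  -- Small coordinates are not moved, hence stay small.
  have hsub : bigIdx εg (x + D) ⊆ bigIdx εg x := by
    intro i hi
    by_contra hni
    have h1 : εg ^ (1 / 2 : ℝ) < |(x + D) i| := (Finset.mem_filter.1 hi).2
    rw [PiLp.add_apply, hD, ext_apply_of_notMem _ _ hni, add_zero] at h1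
    exact hni (Finset.mem_filter.2 ⟨Finset.mem_univ i, h1⟩)
  have hle := norm_sub_le_norm_sub_of_subset hsub (x := gEps f lam εg (x + D))
    (y := gEps f lam εg x + (gradient f (x + D) - gradient f x)) (fun i hi => by
      have h1 : εg ^ (1 / 2 : ℝ) < |(x + D) i| := (Finset.mem_filter.1 hi).2
      have h2 : εg ^ (1 / 2 : ℝ) < |x i| := (Finset.mem_filter.1 (hsub hi)).2
      have h3 := abs_le.1 ((PiLp.norm_apply_le D i).trans (hDn.trans_le hd))
      have h4 : (x + D) i = x i + D i := rfl
      change gEps f lam εg (x + D) i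
        = gEps f lam εg x i + (gradient f (x + D) i - gradient f x i)
      simp only [gEps]
      rcases lt_abs.1 h1 with h1 | h1 <;> rcases lt_abs.1 h2 with h2 | h2
      · rw [if_pos h1, if_pos h2]; ring
      · linarith
      · linarith
      · rw [if_neg (by linarith), if_pos (by linarith), if_neg (by linarith),
          if_pos (by linarith)]; ring)
  have hga := hs.gradient_approx x hx (x + D) hmem
  rw [add_sub_cancel_left, hDn] at hga
  -- New gradient = CG residual - regularization - Taylor error; these supply the terms with `ζ`,
  -- `τhat` and `LH`.
  have hdecomp : sub (bigIdx εg x) (gEps f lam εg x + (gradient f (x + D) - gradient f x))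
      = (sub (bigIdx εg x) (gEps f lam εg x) + (newtonInput f lam εg εh P x τ M).Hb d) - c • d
        - sub (bigIdx εg x) (hess f x D - (gradient f (x + D) - gradient f x)) := by
    rw [CCGInput.Hb_apply, ← hc, map_add, map_sub (sub (bigIdx εg x)) (hess f x D)]
    have : (newtonInput f lam εg εh P x τ M).H d = sub (bigIdx εg x) (hess f x D) := rfl
    rw [this]
    abel
  have h1 : ‖c • d‖ ≤ 2 * P.τhat * εh * ‖d‖ := by
    rw [norm_smul, Real.norm_of_nonneg (by linarith)]
    exact mul_le_mul_of_nonneg_right hc2 (norm_nonneg _)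
  have h2 := (norm_sub_le_norm (bigIdx εg x) _).trans hga
  rw [hdecomp] at hle
  have h3 := hle.trans ((norm_sub_le _ _).trans (add_le_add ((norm_sub_le _ _).trans
    (add_le_add hres h1)) h2))
  linarith

end

/-- The progress is conditional because only a large gradient at the new point rules out a very
short unit Newton step. -/
theorem NewtonStep.decrease (hf : StandingAssumption f lam x₀) (hx : x ∈ levelSet f lam x₀)
    {Lg LH : ℝ} (hs : SmoothnessConstants f lam x₀ Lg LH) (hεg : 0 < εg) (hεh : 0 < εh)
    {P : Params} (hb : NewtonBranch f lam εg x) {x' : E n}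
    (h : NewtonStep f lam εg εh P x x') :
    obj f lam x' ≤ obj f lam x ∧ (NewtonBranch f lam εg x' →
      obj f lam x' ≤ obj f lam x - cMin P Lg LH * progress εg εh) := by
  obtain ⟨τ, hτ, M, -, d, ty, hret, j, hj, rfl⟩ := h
  have hLH := hs.LH_pos
  have hη := P.η_mem.1
  have hθ := P.θ_mem.1
  have hdir := isDescentDir_newtonDir hf hx hεg hεh hb hτ hret
  have hlt := hj.1
  have hle : obj f lam (x + P.θ ^ j • newtonDir f lam εg x d ty) ≤ obj f lam x := by
    have : 0 ≤ P.η * P.θ ^ (2 * j) * εh * ‖newtonDir f lam εg x d ty‖ ^ 2 := by positivity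
    exact hlt.le.trans (by linarith)
  refine ⟨hle, fun hb' => ?_⟩
  rcases hdir.decrease hf hx hs hεg hεh hj with rfl | h
  swap
  · exact h
  rw [Set.mem_ofPred_eq, NewtonSearch, mul_zero, pow_zero, mul_one] at hlt
  rw [pow_zero] at hle hb' ⊢
  refine hlt.le.trans (sub_le_sub_left ?_ _)
  have hcη := (cNC_le P LH).1
  cases ty with
  | NC =>
    have h1 := (isDescentDir_of_nc hεg hεh hb hτ hret).2
    refine (cMin_mul_progress_le P hLH hεg hεh ((min_le_left _ _).trans hcη)
      ((min_le_left _ _).trans (min_le_right _ _))).trans ?_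
    have h2 := pow_le_pow_left₀ hεh.le h1 2
    have h3 := mul_le_mul_of_nonneg_left h2 (show 0 ≤ P.η * εh by positivity)
    linarith
  | SOL =>
    simp only [newtonDir, one_smul] at hle hb' ⊢
    rw [norm_ext]
    rcases le_or_gt ‖d‖ (εg ^ (1 / 2 : ℝ)) with hd | hd
    · have hmem : x + ext (bigIdx εg x) d ∈ levelSet f lam x₀ :=
        hle.trans (show obj f lam x ≤ obj f lam x₀ from hx)
      have h1 := norm_gEps_unit_step_le hf hx hεg hεh hb hτ hs hret hmem hd
      have hb0 : 0 < P.ζ + 4 * P.τhat := by linarith [P.ζ_mem.1, P.one_le_τhat]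
      have h2 := le_of_quadratic hb0 hLH (norm_nonneg d) hεg hεh
        (show 2 * εg < _ by linarith [hb'.2.2])
      have h3 : cMin P Lg LH
          ≤ P.η * (4 / (√((P.ζ + 4 * P.τhat) ^ 2 + 8 * LH) + (P.ζ + 4 * P.τhat))) ^ 2 :=
        ((min_le_right _ _).trans (min_le_right _ _)).trans (mul_le_mul_of_nonneg_left
          ((min_le_left _ _).trans (min_le_left _ _)) hη.le)
      refine (cMin_mul_progress_le P hLH hεg hεh h3 (progress_le_min_sq hεg hεh)).trans ?_
      have h4 := pow_le_pow_left₀ (by positivity) h2 2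
      have h5 := mul_le_mul_of_nonneg_left h4 (show 0 ≤ P.η * εh by positivity)
      rw [mul_pow] at h5
      linarith
    · refine (cMin_mul_progress_le P hLH hεg hεh ((min_le_left _ _).trans hcη)
        ((min_le_left _ _).trans (min_le_left _ _))).trans ?_
      have h3 := pow_le_pow_left₀ (Real.rpow_nonneg hεg.le _) hd.le 2
      rw [rpow_half_sq hεg] at h3
      have h4 := mul_le_mul_of_nonneg_left h3 (show 0 ≤ P.η * εh by positivity)
      linarith

end NewtonStep

/-! ### Counting iterations. -/

section Complexity

variable {n : ℕ} {f : E n → ℝ} {lam εg εh : ℝ} {x₀ x : E n}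

/-- Without a proximal step `gEps` vanishes on the small coordinates, so its whole norm sits on the
large ones. -/
theorem branch_of_not_isWeakFirstOrder (hεg : 0 < εg) (hw : ¬ IsWeakFirstOrder f lam εg x) :
    ProxBranch f lam εg x ∨ NewtonBranch f lam εg x := by
  by_cases hb : ProxBranch f lam εg x
  · exact Or.inl hb
  refine Or.inr ⟨hb, ?_⟩
  have hw' : εg < ‖gEps f lam εg x‖ := not_le.1 hw
  have hzero : ∀ i ∈ smallIdx εg x, gEps f lam εg x i = 0 := by
    intro i hi
    by_contra hne
    refine hb ⟨⟨i, hi⟩, fun h0 => hne ?_⟩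
    exact congrArg (fun v : EuclideanSpace ℝ (smallIdx εg x) => v ⟨i, hi⟩) (norm_eq_zero.1 h0)
  have hnorm : ‖gEps f lam εg x‖ ^ 2 = ‖sub (bigIdx εg x) (gEps f lam εg x)‖ ^ 2 := by
    rw [EuclideanSpace.real_norm_sq_eq, EuclideanSpace.real_norm_sq_eq]
    change _ = ∑ i : bigIdx εg x, gEps f lam εg x i ^ 2
    rw [Finset.sum_coe_sort (bigIdx εg x) fun i => gEps f lam εg x i ^ 2]
    refine (Finset.sum_subset (Finset.subset_univ _) fun i _ hi => ?_).symm
    rw [hzero i, zero_pow two_ne_zero]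
    refine Finset.mem_filter.2 ⟨Finset.mem_univ i, not_lt.1 fun h => hi ?_⟩
    exact Finset.mem_filter.2 ⟨Finset.mem_univ i, h⟩
  rw [sq_eq_sq₀ (norm_nonneg _) (norm_nonneg _)] at hnorm
  rw [hnorm] at hw'
  refine ⟨?_, hw'⟩
  by_contra hne
  rw [Finset.not_nonempty_iff_eq_empty] at hne
  have : sub (bigIdx εg x) (gEps f lam εg x) = 0 := by
    ext i
    exact absurd i.2 (by simp [hne])
  rw [this, norm_zero] at hw'
  linarith

theorem CurvStep.decrease {P : Params} {x' : E n} (h : CurvStep f lam εg εh P x x') :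
    obj f lam x' ≤ obj f lam x := by
  obtain ⟨u, -, -, j, ⟨hj, -⟩, rfl⟩ := h
  have h1 := P.η_mem.1
  have h2 := P.θ_mem.1
  have : 0 ≤ P.η * P.θ ^ (2 * j) * ‖curvDir f lam εg x u‖ ^ 3 := by positivity
  exact (le_of_lt hj).trans (by linarith)

section

variable (hlam : 0 < lam) (hf : StandingAssumption f lam x₀) {Lg LH : ℝ}
  (hs : SmoothnessConstants f lam x₀ Lg LH) (hεg : 0 < εg) (hεh : 0 < εh) {P : Params}

include hlam hf hs hεg hεh

theorem ProxStep.decrease_progress (hx : x ∈ levelSet f lam x₀) (hb : ProxBranch f lam εg x)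
    {x' : E n} (h : ProxStep f lam P x x') :
    obj f lam x' ≤ obj f lam x - cMin P Lg LH * progress εg εh :=
  (h.decrease hlam hf hx hs hεg hb).trans (sub_le_sub_left
    (cMin_mul_progress_le P hs.LH_pos hεg hεh ((min_le_right _ _).trans (min_le_left _ _))
      ((min_le_right _ _).trans (min_le_right _ _))) _)

theorem Step.decrease (hx : x ∈ levelSet f lam x₀) {x' : E n}
    (h : Step f lam εg εh P x x') : obj f lam x' ≤ obj f lam x := by
  rcases h with ⟨hb, h⟩ | ⟨hb, h⟩ | ⟨-, -, h⟩
  · have h1 := h.decrease_progress hlam hf hs hεg hεh hx hb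
    have h2 := mul_pos (cMin_pos P Lg hs.LH_pos) (progress_pos hεg hεh)
    linarith
  · exact (h.decrease hf hx hs hεg hεh hb).1
  · exact h.decrease

theorem IsRun.mem_levelSet {N : ℕ} {x : ℕ → E n} (h : IsRun f lam εg εh P x₀ N x) {k : ℕ}
    (hk : k ≤ N) : x k ∈ levelSet f lam x₀ := by
  induction k with
  | zero => rw [h.1]; exact le_refl (obj f lam x₀)
  | succ k ih =>
    have hk' := ih (by omega)
    exact ((h.2 k hk).decrease hlam hf hs hεg hεh hk').trans
      (show obj f lam (x k) ≤ obj f lam x₀ from hk')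

theorem firstPhaseIterationSucceeds (hx : x ∈ levelSet f lam x₀)
    (hw : ¬ IsWeakFirstOrder f lam εg x) : FirstPhaseIterationSucceeds f lam εg εh P x := by
  rcases branch_of_not_isWeakFirstOrder hεg hw with hb | hb
  · exact Or.inl ⟨hb, exists_proxSearch hlam hf hx hs P hεg hb⟩
  · exact Or.inr ⟨hb, fun τ hτ M _ => ⟨newtonInput_exists_returns hf hx hεg hεh hb hτ,
      fun d ty hret => (isDescentDir_newtonDir hf hx hεg hεh hb hτ hret).exists_newtonSearch
        hf hx hs hεg hεh⟩⟩

/-- Two consecutive first phase iterations make progress. -/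
theorem two_steps_decrease {x' x'' : E n} (hx : x ∈ levelSet f lam x₀)
    (h : Step f lam εg εh P x x') (h' : Step f lam εg εh P x' x'')
    (hw : ¬ IsWeakFirstOrder f lam εg x) (hw' : ¬ IsWeakFirstOrder f lam εg x') :
    obj f lam x'' ≤ obj f lam x - cMin P Lg LH * progress εg εh := by
  have h1 := h.decrease hlam hf hs hεg hεh hx
  have hx' : x' ∈ levelSet f lam x₀ := h1.trans (show obj f lam x ≤ obj f lam x₀ from hx)
  have h2 := h'.decrease hlam hf hs hεg hεh hx'
  rcases h with ⟨hb, h⟩ | ⟨hb, h⟩ | ⟨hb, hb', -⟩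
  · linarith [h.decrease_progress hlam hf hs hεg hεh hx hb]
  -- After a Newton step, a following proximal step supplies the progress itself, while a following
  -- Newton step certifies that of its predecessor.
  · rcases branch_of_not_isWeakFirstOrder hεg hw' with hc | hc
    · rcases h' with ⟨-, h'⟩ | ⟨hc', -⟩ | ⟨hc', -, -⟩
      · linarith [h'.decrease_progress hlam hf hs hεg hεh hx' hc]
      · exact absurd hc hc'.1
      · exact absurd hc hc'
    · linarith [(h.decrease hf hx hs hεg hεh hb).2 hc]
  · rcases branch_of_not_isWeakFirstOrder hεg hw with hc | hc
    · exact absurd hc hb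
    · exact absurd hc hb'

/-- The `K` iterations contain `K / 2` disjoint pairs, each gaining `q`, and `2 * (K / 2) ≥ K - 1`.
-/
theorem reachesWithin {φlow : ℝ} (hlow : ∀ y, φlow ≤ obj f lam y) {K : ℕ}
    (hK : 2 * (obj f lam x₀ - φlow) < (K - 1) * (cMin P Lg LH * progress εg εh)) :
    ReachesWithin f lam εg εh P x₀ K := by
  refine ⟨fun N x hrun hw => firstPhaseIterationSucceeds hlam hf hs hεg hεh
    (hrun.mem_levelSet hlam hf hs hεg hεh le_rfl) hw, fun x hrun => ?_⟩
  by_contra! hcon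
  set q := cMin P Lg LH * progress εg εh with hq
  have hq0 : 0 < q := mul_pos (cMin_pos P Lg hs.LH_pos) (progress_pos hεg hεh)
  have key : ∀ m : ℕ, 2 * m ≤ K → obj f lam (x (2 * m)) ≤ obj f lam x₀ - m * q := by
    intro m
    induction m with
    | zero => intro _; simp [hrun.1]
    | succ m ih =>
      intro hm
      have h1 := two_steps_decrease hlam hf hs hεg hεh
        (hrun.mem_levelSet hlam hf hs hεg hεh (k := 2 * m) (by omega))
        (hrun.2 (2 * m) (by omega)) (hrun.2 (2 * m + 1) (by omega))
        (hcon _ (by omega)) (hcon _ (by omega))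
      have h2 := ih (by omega)
      rw [show 2 * (m + 1) = 2 * m + 1 + 1 by ring]
      push_cast
      linarith
  have h1 := key (K / 2) (by omega)
  have h2 := hlow (x (2 * (K / 2)))
  have h3 : (K : ℝ) - 1 ≤ 2 * (K / 2 : ℕ) := by
    have : K ≤ 2 * (K / 2) + 1 := by omega
    have : (K : ℝ) ≤ 2 * (K / 2 : ℕ) + 1 := by exact_mod_cast this
    linarith
  have h4 := mul_le_mul_of_nonneg_right h3 hq0.le
  linarith

/-- The summand 2 leaves one spare `q` after the parity loss, so the inequality is strict even when
`x₀` is already a minimizer. -/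
theorem reachesWithin_of_inv {φlow : ℝ} (hlow : ∀ y, φlow ≤ obj f lam y) {m : ℝ}
    (hm : (progress εg εh)⁻¹ ≤ m) :
    ReachesWithin f lam εg εh P x₀
      (⌈3 * (obj f lam x₀ - φlow) / cMin P Lg LH * m⌉₊ + 2) := by
  have hc := cMin_pos P Lg hs.LH_pos
  have hp := progress_pos hεg hεh
  have hΔ : 0 ≤ obj f lam x₀ - φlow := sub_nonneg.2 (hlow x₀)
  refine reachesWithin hlam hf hs hεg hεh hlow ?_
  have h1 := Nat.le_ceil (3 * (obj f lam x₀ - φlow) / cMin P Lg LH * m)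
  have h2 : 3 * (obj f lam x₀ - φlow) / cMin P Lg LH * (progress εg εh)⁻¹
      ≤ 3 * (obj f lam x₀ - φlow) / cMin P Lg LH * m :=
    mul_le_mul_of_nonneg_left hm (by positivity)
  have h3 := mul_le_mul_of_nonneg_right (h2.trans h1) (mul_pos hc hp).le
  have h4 : 3 * (obj f lam x₀ - φlow) / cMin P Lg LH * (progress εg εh)⁻¹
      * (cMin P Lg LH * progress εg εh) = 3 * (obj f lam x₀ - φlow) := by
    field_simp
  rw [h4] at h3
  push_cast
  have h5 := mul_pos hc hp
  linarith

end

theorem inv_progress_le (hεg : 0 < εg) (hεh : 0 < εh) :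
    (progress εg εh)⁻¹ ≤ max (max (εg ^ (-1 : ℝ) * εh ^ (-1 : ℝ)) (εh ^ (-3 : ℝ)))
      (max (εg ^ (-2 : ℝ) * εh) (εg ^ (-(3 / 2) : ℝ))) := by
  have e1 : εg ^ (-1 : ℝ) * εh ^ (-1 : ℝ) = (εg * εh)⁻¹ := by
    rw [Real.rpow_neg_one, Real.rpow_neg_one, mul_inv]
  have e2 : εh ^ (-3 : ℝ) = (εh ^ 3)⁻¹ := by
    rw [Real.rpow_neg hεh.le]; norm_cast
  have e3 : εg ^ (-2 : ℝ) * εh = (εg ^ 2 / εh)⁻¹ := by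
    rw [Real.rpow_neg hεg.le, inv_div, div_eq_inv_mul]; norm_cast
  have e4 : εg ^ (-(3 / 2) : ℝ) = (εg ^ (3 / 2 : ℝ))⁻¹ := Real.rpow_neg hεg.le _
  rw [e1, e2, e3, e4]
  unfold progress
  rcases min_choice (min (εg * εh) (εh ^ 3)) (min (εg ^ 2 / εh) (εg ^ (3 / 2 : ℝ))) with h | h <;>
    rw [h]
  · rcases min_choice (εg * εh) (εh ^ 3) with h | h <;> rw [h] <;> simp
  · rcases min_choice (εg ^ 2 / εh) (εg ^ (3 / 2 : ℝ)) with h | h <;> rw [h] <;> simp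

/-- For this coupling of the tolerances all four terms of the minimum coincide. -/
theorem progress_sqrt {ε : ℝ} (hε : 0 < ε) : progress ε (ε ^ (1 / 2 : ℝ)) = ε ^ (3 / 2 : ℝ) := by
  have e1 : ε * ε ^ (1 / 2 : ℝ) = ε ^ (3 / 2 : ℝ) := by
    nth_rw 1 [← Real.rpow_one ε]
    rw [← Real.rpow_add hε]; norm_num
  have e2 : (ε ^ (1 / 2 : ℝ)) ^ 3 = ε ^ (3 / 2 : ℝ) := by
    rw [← Real.rpow_natCast, ← Real.rpow_mul hε.le]; norm_num
  have e3 : ε ^ 2 / ε ^ (1 / 2 : ℝ) = ε ^ (3 / 2 : ℝ) := by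
    rw [← Real.rpow_natCast, ← Real.rpow_sub hε]; norm_num
  rw [progress, e1, e2, e3]
  simp

end Complexity

end PGN2CM

end

theorem mainTheorem2 (n : ℕ) (f : PGN2CM.E n → ℝ) (lam : ℝ) (hlam : 0 < lam)
    (x₀ : PGN2CM.E n) (hf : PGN2CM.StandingAssumption f lam x₀)
    (φlow : ℝ) (hφlow : IsLeast (Set.range (PGN2CM.obj f lam)) φlow) :
    (∃ Lg LH : ℝ, PGN2CM.SmoothnessConstants f lam x₀ Lg LH) ∧
    ∀ Lg LH : ℝ, PGN2CM.SmoothnessConstants f lam x₀ Lg LH → ∀ P : PGN2CM.Params,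
      (∀ εg εh : ℝ, 0 < εg → εg < 1 → 0 < εh → εh < 1 →
        PGN2CM.ReachesWithin f lam εg εh P x₀
          (⌈3 * (PGN2CM.obj f lam x₀ - φlow) / PGN2CM.cMin P Lg LH *
            max (max (εg ^ (-1 : ℝ) * εh ^ (-1 : ℝ)) (εh ^ (-3 : ℝ)))
              (max (εg ^ (-2 : ℝ) * εh) (εg ^ (-(3 / 2) : ℝ)))⌉₊ + 2)) ∧
      (∀ ε : ℝ, 0 < ε → ε < 1 →
        PGN2CM.ReachesWithin f lam ε (ε ^ (1 / 2 : ℝ)) P x₀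
          (⌈3 * (PGN2CM.obj f lam x₀ - φlow) / PGN2CM.cMin P Lg LH *
            ε ^ (-(3 / 2) : ℝ)⌉₊ + 2)) := by
  have hlow : ∀ y, φlow ≤ PGN2CM.obj f lam y := fun y => hφlow.2 ⟨y, rfl⟩
  refine ⟨hf.exists_smoothnessConstants, fun Lg LH hs P => ⟨fun εg εh hεg _ hεh _ => ?_,
    fun ε hε _ => ?_⟩⟩
  · exact PGN2CM.reachesWithin_of_inv hlam hf hs hεg hεh hlow (PGN2CM.inv_progress_le hεg hεh)
  · refine PGN2CM.reachesWithin_of_inv hlam hf hs hε (Real.rpow_pos_of_pos hε _) hlow ?_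
    rw [PGN2CM.progress_sqrt hε, Real.rpow_neg hε.le]
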